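/- Setting. Let $\mathsf P_{Y|X}$ be a discrete memoryless channel with finite input alphabet $\mathcal X$ and finite output alphabet $\mathcal Y$ and capacity $C$; all logarithms have base $2$. Let $D(\cdot\|\cdot)$ be the Kullback--Leibler divergence, with $0\log\frac0a=0$ and $b\log\frac b0=\infty$ for $b\neq0$, and let $$E_{\mathrm r}(R)=\max_{0\le\rho\le1}\ \max_{Q}\Big\{-\log_2\sum_{y}\Big(\sum_{x}Q(x)\,\mathsf P_{Y|X}(y|x)^{\frac1{1+\rho}}\Big)^{1+\rho}-\rho R\Big\}$$ be the random coding exponent, where $Q$ ranges over the distributions on $\mathcal X$. Codes. An $(\ell,M,\gamma,K,\epsilon)$ almost-fixed-length feedback (AFLF) code, with $\epsilon\in(0,1)$, consists of: a common randomness $U\in\mathcal U$ known to encoder and decoder; an equiprobable message $W\in\{1,\dots,M\}$ independent of $U$; encoders $f_n:\mathcal U\times\{1,\dots,M\}\times\mathcal Y^{n-1}\to\mathcal X$ giving the channel inputs $X_n=f_n(U,W,Y^{n-1})$, where, conditionally on $(U,W,Y^{n-1})$, the output $Y_n$ has law $\mathsf P_{Y|X}(\cdot|X_n)$; decoders $g_n:\mathcal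 U\times\mathcal Y^n\to\{1,\dots,M\}$; and a stopping time $\tau\ge1$ of the filtration $\sigma(U,Y^n)$ such that $$\mathsf P(\tau>\ell)\le2^{-\gamma\ell},\qquad \tau\le K\ell\ \text{ a.s.},\qquad \mathsf P\big(g_\tau(U,Y^\tau)\ne W\big)\le\epsilon .$$ A pair $(R,E)$ is achievable in a $(\gamma,K)$-almost-fixed-length manner with feedback if for every $\delta>0$ there is $\ell(\delta)\in\mathbb N$ such that for every $\ell\ge\ell(\delta)$ there is an $(\ell,M_\ell,\gamma,K,\epsilon_\ell)$ AFLF code with $M_\ell\ge2^{\ell R}$ and $\epsilon_\ell\le2^{-\ell(E-\delta)}$. The reliability function $\mathcal E_{\mathrm{AFLF}}(R,\gamma,K)\in[-\infty,\infty]$ is the supremum of the $E\in\mathbb R$ for which $(R,E)$ is achievable. Theorem (strictly positive $\gamma$). Let $0\le R<C$, let $K\ge1$ be an integer, and let $x,x'\in\mathcal X$ be two inputs for which $D(\mathsf P_{Y|X}(\cdot|x)\,\|\,\mathsf P_{Y|X}(\cdot|x'))$ is maximal among all pairs of inputs. (1) Let $R>0$ and $0<\gamma<E_{\mathrm r}(R)$,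 and put $g(a)=E_{\mathrm r}(a)/a$ for $a>0$. Then there is exactly one $a>0$ with $g(a)=\gamma/R$, denoted $g^{-1}(\gamma/R)$. With $\alpha^*(R,\gamma)=R/g^{-1}(\gamma/R)$, $$\mathcal E_{\mathrm{AFLF}}(R,\gamma,K)\ \ge\ \min\Big\{E'_{\mathrm{ee}}(R,\gamma),\ (K-1)\,E_{\mathrm r}\Big(\frac R{K-1}\Big)\Big\},$$ where the second term is $0$ if $K=1$, and where $$E'_{\mathrm{ee}}(R,\gamma)=\sup_{\alpha\in[\alpha^*(R,\gamma),1]}\ \ \sup_{\substack{\lambda\in[0,1]\\(1-\alpha)D(\mathsf P^{(\lambda)}\|\mathsf P_{Y|X}(\cdot|x))\ge\gamma}}\Big\{\alpha E_{\mathrm r}\Big(\frac R\alpha\Big)+(1-\alpha)\,D\big(\mathsf P^{(\lambda)}\,\|\,\mathsf P_{Y|X}(\cdot|x')\big)\Big\}$$ (with $\sup\emptyset=-\infty$ and $0\cdot\infty=0$), and the $\lambda$-tilted distribution is $$\mathsf P^{(\lambda)}(y)=\frac{\mathsf P_{Y|X}(y|x)^{1-\lambda}\,\mathsf P_{Y|X}(y|x')^{\lambda}}{\sum_{a\in\mathcal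 Y}\mathsf P_{Y|X}(a|x)^{1-\lambda}\,\mathsf P_{Y|X}(a|x')^{\lambda}},\qquad 0^0=1$$ (values of $\lambda$ for which the denominator vanishes are not admitted). (2) If $\gamma>E_{\mathrm r}(R)$, then $\mathcal E_{\mathrm{AFLF}}(R,\gamma,K)\ge E_{\mathrm r}(R)$. -/

import Mathlib

open MeasureTheory ProbabilityTheory

universe u v

noncomputable section

namespace AFLF

/-! A discrete memoryless channel with finite input alphabet `𝒳` and finite output alphabet `𝒴`
is a stochastic matrix `P : 𝒳 → 𝒴 → ℝ`, where `P x y` is the probability of the output `y` given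
the input `x`. All logarithms are to base `2`. -/

section Information

variable {𝒳 : Type u} {𝒴 : Type v} [Fintype 𝒳] [Fintype 𝒴]

/-- Kullback-Leibler divergence in bits, with `0 log (0 / a) = 0` and
`b log (b / 0) = ∞` for `b ≠ 0`. -/
def kl (p q : 𝒴 → ℝ) : EReal :=
  open scoped Classical in
  if ∀ y, q y = 0 → p y = 0 then ((∑ y, p y * Real.logb 2 (p y / q y) : ℝ) : EReal) else ⊤

/-- Mutual information in bits between the input and the output of the channel `P` when the
input has distribution `Q`. -/
def mutualInfo (P : 𝒳 → 𝒴 → ℝ) (Q : 𝒳 → ℝ) : ℝ :=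
  ∑ x, ∑ y, Q x * P x y * Real.logb 2 (P x y / ∑ a, Q a * P a y)

/-- Capacity of the channel: the maximal mutual information over the input distributions. -/
def capacity (P : 𝒳 → 𝒴 → ℝ) : ℝ :=
  sSup (mutualInfo P '' stdSimplex ℝ 𝒳)

/-- Gallager's function
`E₀(ρ, Q) = - log₂ ∑_y (∑_x Q(x) P(y|x)^{1/(1+ρ)})^{1+ρ}`. -/
def gallagerE0 (P : 𝒳 → 𝒴 → ℝ) (ρ : ℝ) (Q : 𝒳 → ℝ) : ℝ :=
  -Real.logb 2 (∑ y, (∑ x, Q x * P x y ^ (1 / (1 + ρ))) ^ (1 + ρ))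

/-- Random coding exponent
`E_r(R) = max_{0 ≤ ρ ≤ 1} max_Q (E₀(ρ, Q) - ρ R)`. -/
def Er (P : 𝒳 → 𝒴 → ℝ) (R : ℝ) : ℝ :=
  sSup ((fun s : ℝ × (𝒳 → ℝ) => gallagerE0 P s.1 s.2 - s.1 * R) ''
    (Set.Icc (0 : ℝ) 1 ×ˢ stdSimplex ℝ 𝒳))

/-- `g(a) = E_r(a) / a`. -/
def g (P : 𝒳 → 𝒴 → ℝ) (a : ℝ) : ℝ := Er P a / a

/-- `α*(R, γ) = R / g⁻¹(γ / R)`, where `g` is regarded as a function on `(0, ∞)`. -/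
def alphaStar (P : 𝒳 → 𝒴 → ℝ) (R γ : ℝ) : ℝ :=
  R / Function.invFunOn (g P) (Set.Ioi 0) (γ / R)

/-- The `lam`-tilted distribution between the output distributions of the inputs `x` and `x'`.
Since `0 ^ 0 = 1`, it is `P x` for `lam = 0` and `P x'` for `lam = 1`. -/
def tilted (P : 𝒳 → 𝒴 → ℝ) (x x' : 𝒳) (lam : ℝ) (y : 𝒴) : ℝ :=
  P x y ^ (1 - lam) * P x' y ^ lam / ∑ a, P x a ^ (1 - lam) * P x' a ^ lam

/-- `E''_ee(α, lam, R)`. -/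
def Eee'' (P : 𝒳 → 𝒴 → ℝ) (x x' : 𝒳) (α lam R : ℝ) : EReal :=
  ((α * Er P (R / α) : ℝ) : EReal) + ((1 - α : ℝ) : EReal) * kl (tilted P x x' lam) (P x')

/-- `E'_ee(R, γ)`: the supremum of `E''_ee(α, lam, R)` over `α ∈ [α*(R, γ), 1]` and over
`lam ∈ [0, 1]` with `(1 - α) D(P^(lam) ‖ P(·|x)) ≥ γ`. -/
def Eee' (P : 𝒳 → 𝒴 → ℝ) (x x' : 𝒳) (R γ : ℝ) : EReal :=
  ⨆ α ∈ Set.Icc (alphaStar P R γ) 1,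
    ⨆ lam ∈ {lam : ℝ | lam ∈ Set.Icc (0 : ℝ) 1 ∧
        (γ : EReal) ≤ ((1 - α : ℝ) : EReal) * kl (tilted P x x' lam) (P x)},
      Eee'' P x x' α lam R

end Information

section Codes

variable {𝒳 : Type u} {𝒴 : Type v} [MeasurableSpace 𝒳] [MeasurableSpace 𝒴]

/-- Transmission of one of `M` messages over the channel `P` with noiseless feedback: the common
randomness, the message, the encoders and decoders, and the outputs they generate. Time is counted
from `0` in the indices: `out n` is the output of the `(n+1)`-st channel use. -/
structure FeedbackScheme (P : 𝒳 → 𝒴 → ℝ) (M : ℕ) where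
  /-- the set of values of the common randomness -/
  𝒰 : Type (max u v)
  [mU : MeasurableSpace 𝒰]
  /-- the underlying probability space -/
  Ω : Type (max u v)
  [mΩ : MeasurableSpace Ω]
  μ : Measure Ω
  [prob : IsProbabilityMeasure μ]
  /-- the common randomness -/
  U : Ω → 𝒰
  measurable_U : Measurable U
  /-- the message -/
  msg : Ω → Fin M
  measurable_msg : Measurable msg
  /-- the channel outputs -/
  out : ℕ → Ω → 𝒴
  measurable_out : ∀ n, Measurable (out n)
  /-- `enc n` computes the input of the `(n+1)`-st channel use from the common randomness, the
  message and the first `n` outputs -/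
  enc : (n : ℕ) → 𝒰 → Fin M → (Fin n → 𝒴) → 𝒳
  measurable_enc : ∀ n w y, Measurable fun c => enc n c w y
  /-- `dec n` estimates the message from the common randomness and the first `n` outputs -/
  dec : (n : ℕ) → 𝒰 → (Fin n → 𝒴) → Fin M
  measurable_dec : ∀ n y, Measurable fun c => dec n c y
  /-- the message is equiprobable -/
  msg_uniform : ∀ w, μ.real {ω | msg ω = w} = 1 / (M : ℝ)
  /-- the common randomness does not depend on the message -/
  indep : IndepFun U msg μ
  /-- the channel is memoryless: given the common randomness, the message and the past, the
  output of the next channel use has distribution `P x` if the input is `x` -/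
  memoryless : ∀ (n : ℕ) (A : Set 𝒰), MeasurableSet A →
    ∀ (w : Fin M) (y : Fin n → 𝒴) (x : 𝒳) (b : 𝒴),
      μ.real {ω | U ω ∈ A ∧ msg ω = w ∧ (fun i : Fin n => out i ω) = y ∧
          enc n (U ω) (msg ω) (fun i : Fin n => out i ω) = x ∧ out n ω = b} =
        P x b * μ.real {ω | U ω ∈ A ∧ msg ω = w ∧ (fun i : Fin n => out i ω) = y ∧
          enc n (U ω) (msg ω) (fun i : Fin n => out i ω) = x}

namespace FeedbackScheme

attribute [instance] FeedbackScheme.mU FeedbackScheme.mΩ FeedbackScheme.prob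

variable {P : 𝒳 → 𝒴 → ℝ} {M : ℕ}

/-- What the decoder knows after `n` channel uses: the common randomness and `n` outputs. -/
def observed (S : FeedbackScheme P M) (n : ℕ) (ω : S.Ω) : S.𝒰 × (Fin n → 𝒴) :=
  (S.U ω, fun i => S.out i ω)

/-- The filtration generated by the common randomness and the outputs. -/
def filtration (S : FeedbackScheme P M) : Filtration ℕ S.mΩ where
  seq n := MeasurableSpace.comap (S.observed n) inferInstance
  mono' := by
    intro m n hmn
    have h : S.observed m =
        (fun p : S.𝒰 × (Fin n → 𝒴) => (p.1, fun i : Fin m => p.2 (Fin.castLE hmn i))) ∘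
          S.observed n := rfl
    have hm : Measurable
        (fun p : S.𝒰 × (Fin n → 𝒴) => (p.1, fun i : Fin m => p.2 (Fin.castLE hmn i))) := by
      fun_prop
    change MeasurableSpace.comap (S.observed m) inferInstance ≤ _
    rw [h, ← MeasurableSpace.comap_comp]
    exact MeasurableSpace.comap_mono hm.comap_le
  le' n := Measurable.comap_le
    (S.measurable_U.prodMk (measurable_pi_lambda _ fun i => S.measurable_out i))

/-- With the stopping time `τ`, the scheme is an `(ℓ, M, γ, K, ε)` almost-fixed-length feedback
code. -/
structure IsAFLF (S : FeedbackScheme P M) (τ : S.Ω → ℕ) (ℓ : ℕ) (γ : ℝ) (K : ℕ) (ε : ℝ) :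
    Prop where
  eps_mem : ε ∈ Set.Ioo (0 : ℝ) 1
  stopping : IsStoppingTime S.filtration fun ω => (τ ω : WithTop ℕ)
  pos : ∀ ω, 1 ≤ τ ω
  exceed : S.μ.real {ω | ℓ < τ ω} ≤ (2 : ℝ) ^ (-(γ * ℓ))
  bounded : ∀ᵐ ω ∂S.μ, τ ω ≤ K * ℓ
  error : S.μ.real {ω | S.dec (τ ω) (S.U ω) (fun i : Fin (τ ω) => S.out i ω) ≠ S.msg ω} ≤ ε

end FeedbackScheme

/-- The pair `(R, E)` is achievable in a `(γ, K)`-almost-fixed-length manner with feedback. -/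
def Achievable (P : 𝒳 → 𝒴 → ℝ) (γ : ℝ) (K : ℕ) (R E : ℝ) : Prop :=
  ∀ δ : ℝ, 0 < δ → ∃ ℓ₀ : ℕ, ∀ ℓ : ℕ, ℓ₀ ≤ ℓ →
    ∃ (M : ℕ) (ε : ℝ) (S : FeedbackScheme P M) (τ : S.Ω → ℕ),
      S.IsAFLF τ ℓ γ K ε ∧ (2 : ℝ) ^ (ℓ * R) ≤ M ∧ ε ≤ (2 : ℝ) ^ (-(ℓ * (E - δ)))

/-- The reliability function: the best error exponent that is achievable at rate `R` in a
`(γ, K)`-almost-fixed-length manner with feedback (possibly `∞`). -/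
def reliability (P : 𝒳 → 𝒴 → ℝ) (R γ : ℝ) (K : ℕ) : EReal :=
  ⨆ E ∈ {E : ℝ | Achievable P γ K R E}, (E : EReal)

end Codes

end AFLF

end

/-! Two coding strategies prove the theorem. The plain block code of length `ℓ`, stopped at the
constant time `ℓ`, attains `Er P R` by Gallager's random coding bound (`achievable_Er`). This gives
part (2), and it also covers the degenerate cases of part (1).

The main strategy spends about `α ℓ` uses on a block code. By feedback the encoder knows the
tentative decision and uses the remaining uses up to time `ℓ` to repeat `x` if the decision is right
and `x'` if it is wrong. The receiver runs a likelihood ratio test: on acceptance it stops at time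
`ℓ`, otherwise the message is sent again by a block code of length `(K - 1) ℓ`. Going past time `ℓ`
requires a first decoding error or a false alarm, so its exponent is the smaller of `α Er (R / α)`
and the false-alarm exponent. A final error requires a first decoding error together with a missed
detection, whose exponents add, or an error in the retransmission, of exponent `(K - 1) Er (R / (K -
1))`. Chernoff's bounds for a test thresholded at the mean log-likelihood ratio under the tilted law
have exactly the two divergences as exponents (`sum_accept_le`, `sum_reject_le`,
`exists_kl_tilted_eq`).

These bounds need strict inequalities, whereas the constraints on `α` and `lam` are closed.
`le_reliability_of_lt` gains the slack by slightly lowering the threshold and then slightly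
increasing `α`. Finally, the codes must be realised on a probability space: the channel is modelled
by independent answers to every input at every time, from which feedback outputs are read off
recursively (`detScheme`). -/

namespace AFLF

/-! ### Random coding bound for one channel use. -/

section Gallager

variable {A B : Type*} [Fintype A] [Fintype B]

lemma sum_prod_eq_one {q : A → ℝ} (hq : ∑ a, q a = 1) (m : ℕ) :
    ∑ c : Fin m → A, ∏ j, q (c j) = 1 := by
  classical
  rw [← Fintype.piFinset_univ, ← Finset.prod_univ_sum]
  simp [hq]

lemma sum_prod_mul_apply {q : A → ℝ} (hq : ∑ a, q a = 1) (F : A → ℝ) {m : ℕ} (j : Fin m) :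
    ∑ c : Fin m → A, (∏ i, q (c i)) * F (c j) = ∑ a, q a * F a := by
  classical
  have h : ∀ c : Fin m → A, (∏ i, q (c i)) * F (c j) =
      ∏ i, (q (c i) * if i = j then F (c i) else 1) := by
    intro c
    rw [Finset.prod_mul_distrib]
    simp
  simp_rw [h]
  rw [← Fintype.piFinset_univ,
    ← Finset.prod_univ_sum (fun _ => Finset.univ) (fun i a => q a * if i = j then F a else 1),
    ← Finset.mul_prod_erase _ _ (Finset.mem_univ j), Finset.prod_eq_one]
  · simp
  · intro i hi
    simp [Finset.ne_of_mem_erase hi, hq]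

/-- Splitting off one codeword and applying Jensen's inequality to the others. -/
lemma sum_prod_mul_rpow_le {q : A → ℝ} (hq : q ∈ stdSimplex ℝ A) {F : A → ℝ} (hF : ∀ a, 0 ≤ F a)
    {m : ℕ} (w : Fin (m + 1)) {ρ : ℝ} (h0 : 0 ≤ ρ) (h1 : ρ ≤ 1) :
    ∑ c : Fin (m + 1) → A, (∏ i, q (c i)) *
        (F (c w) * (∑ j, F (c (w.succAbove j))) ^ ρ) ≤
      (m : ℝ) ^ ρ * (∑ a, q a * F a) ^ (1 + ρ) := by
  have hS : 0 ≤ ∑ a, q a * F a := Finset.sum_nonneg fun a _ => mul_nonneg (hq.1 a) (hF a)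
  rw [← (Fin.insertNthEquiv (fun _ => A) w).sum_comp]
  simp only [Fintype.sum_prod_type, Fin.insertNthEquiv_apply, Fin.prod_univ_succAbove _ w,
    Fin.insertNth_apply_same, Fin.insertNth_apply_succAbove]
  have key : ∑ c : Fin m → A, (∏ i, q (c i)) * (∑ j, F (c j)) ^ ρ ≤
      ((m : ℝ) * ∑ a, q a * F a) ^ ρ := by
    have hJ := (Real.concaveOn_rpow h0 h1).le_map_sum (t := Finset.univ)
      (w := fun c : Fin m → A => ∏ i, q (c i)) (p := fun c => ∑ j, F (c j))
      (fun c _ => Finset.prod_nonneg fun i _ => hq.1 _) (sum_prod_eq_one hq.2 m)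
      (fun c _ => Finset.sum_nonneg fun j _ => hF _)
    simp only [smul_eq_mul] at hJ
    refine hJ.trans (le_of_eq ?_)
    congr 1
    simp_rw [Finset.mul_sum]
    rw [Finset.sum_comm]
    simp_rw [sum_prod_mul_apply hq.2 F]
    simp [Finset.mul_sum]
  calc ∑ a, ∑ c : Fin m → A, q a * (∏ i, q (c i)) * (F a * (∑ j, F (c j)) ^ ρ)
      = (∑ a, q a * F a) * ∑ c : Fin m → A, (∏ i, q (c i)) * (∑ j, F (c j)) ^ ρ := by
        rw [Finset.sum_mul_sum]
        exact Finset.sum_congr rfl fun a _ => Finset.sum_congr rfl fun c _ => by ring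
    _ ≤ (∑ a, q a * F a) * ((m : ℝ) * ∑ a, q a * F a) ^ ρ := by gcongr
    _ = _ := by
        rw [Real.mul_rpow (Nat.cast_nonneg m) hS, Real.rpow_add' hS (by positivity),
          Real.rpow_one]
        ring

/-- Gallager's bound for a single use of a channel: some code with `m + 1` messages, decoded by
maximum likelihood, does at least as well as the random code. -/
lemma exists_code_le (q : A → ℝ) (hq : q ∈ stdSimplex ℝ A) (p : A → B → ℝ)
    (hp : ∀ a b, 0 ≤ p a b) (m : ℕ) {ρ : ℝ} (h0 : 0 ≤ ρ) (h1 : ρ ≤ 1) :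
    ∃ (c : Fin (m + 1) → A) (d : B → Fin (m + 1)),
      ∑ w, ∑ b, (if d b ≠ w then p (c w) b else 0) ≤
        ((m : ℝ) + 1) * ((m : ℝ) ^ ρ * ∑ b, (∑ a, q a * p a b ^ (1 / (1 + ρ))) ^ (1 + ρ)) := by
  have hA : Nonempty A := by
    by_contra h
    rw [not_nonempty_iff] at h
    simpa using hq.2
  have hd : ∀ c : Fin (m + 1) → A, ∃ d : B → Fin (m + 1), ∀ b w, p (c w) b ≤ p (c (d b)) b :=
    fun c => by
      choose d hd using fun b => Finite.exists_max fun w => p (c w) b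
      exact ⟨d, hd⟩
  choose d hd using hd
  -- The best codebook is no worse than the average over random codebooks.
  obtain ⟨c₀, hc₀⟩ := Finite.exists_min fun c : Fin (m + 1) → A =>
    ∑ w, ∑ b, (if d c b ≠ w then p (c w) b else 0)
  refine ⟨c₀, d c₀, ?_⟩
  -- An error at `b` means that some other codeword is at least as likely as `c w`, so the second
  -- factor is at least `(p (c w) b ^ (1 / (1 + ρ))) ^ ρ`, and the exponents `1 / (1 + ρ)` and `ρ /
  -- (1 + ρ)` add up to one.
  have hpt : ∀ (c : Fin (m + 1) → A) w b, (if d c b ≠ w then p (c w) b else 0) ≤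
      p (c w) b ^ (1 / (1 + ρ)) * (∑ j, p (c (w.succAbove j)) b ^ (1 / (1 + ρ))) ^ ρ := by
    intro c w b
    have hnn : ∀ a, 0 ≤ p a b ^ (1 / (1 + ρ)) := fun a => Real.rpow_nonneg (hp a b) _
    split_ifs with h
    · obtain ⟨j, hj⟩ := Fin.exists_succAbove_eq h
      have e : p (c w) b = p (c w) b ^ (1 / (1 + ρ)) * (p (c w) b ^ (1 / (1 + ρ))) ^ ρ := by
        have h2 : 1 / (1 + ρ) + 1 / (1 + ρ) * ρ = 1 := by field_simp
        rw [← Real.rpow_mul (hp _ _), ← Real.rpow_add' (hp _ _) (by rw [h2]; exact one_ne_zero),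
          h2, Real.rpow_one]
      calc p (c w) b = _ := e
        _ ≤ p (c w) b ^ (1 / (1 + ρ)) * (p (c (w.succAbove j)) b ^ (1 / (1 + ρ))) ^ ρ := by
          have := hd c b w
          rw [← hj] at this
          have h3 := hp (c w) b
          have h4 := hnn (c w)
          gcongr
        _ ≤ _ := by
          refine mul_le_mul_of_nonneg_left (Real.rpow_le_rpow (hnn _) ?_ h0) (hnn _)
          exact Finset.single_le_sum (f := fun j => p (c (w.succAbove j)) b ^ (1 / (1 + ρ)))
            (fun j _ => hnn _) (Finset.mem_univ j)
    · exact mul_nonneg (hnn _) (Real.rpow_nonneg (Finset.sum_nonneg fun j _ => hnn _) _)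
  have hw : ∀ c : Fin (m + 1) → A, 0 ≤ ∏ i, q (c i) := fun c =>
    Finset.prod_nonneg fun i _ => hq.1 _
  calc ∑ w, ∑ b, (if d c₀ b ≠ w then p (c₀ w) b else 0)
      = ∑ c : Fin (m + 1) → A, (∏ i, q (c i)) *
          ∑ w, ∑ b, (if d c₀ b ≠ w then p (c₀ w) b else 0) := by
        rw [← Finset.sum_mul, sum_prod_eq_one hq.2, one_mul]
    _ ≤ ∑ c : Fin (m + 1) → A, (∏ i, q (c i)) * ∑ w, ∑ b, p (c w) b ^ (1 / (1 + ρ)) *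
          (∑ j, p (c (w.succAbove j)) b ^ (1 / (1 + ρ))) ^ ρ :=
        Finset.sum_le_sum fun c _ => mul_le_mul_of_nonneg_left ((hc₀ c).trans
          (Finset.sum_le_sum fun w _ => Finset.sum_le_sum fun b _ => hpt c w b)) (hw c)
    _ = ∑ w : Fin (m + 1), ∑ b, ∑ c : Fin (m + 1) → A, (∏ i, q (c i)) *
          (p (c w) b ^ (1 / (1 + ρ)) *
          (∑ j, p (c (w.succAbove j)) b ^ (1 / (1 + ρ))) ^ ρ) := by
        simp_rw [Finset.mul_sum]
        rw [Finset.sum_comm]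
        exact Finset.sum_congr rfl fun w _ => Finset.sum_comm
    _ ≤ ∑ _w : Fin (m + 1), ∑ b, (m : ℝ) ^ ρ * (∑ a, q a * p a b ^ (1 / (1 + ρ))) ^ (1 + ρ) :=
        Finset.sum_le_sum fun w _ => Finset.sum_le_sum fun b _ =>
          sum_prod_mul_rpow_le hq (fun a => Real.rpow_nonneg (hp a b) _) w h0 h1
    _ = _ := by simp [Finset.mul_sum]

end Gallager

/-! ### Random coding bound for memoryless blocks. -/

section BlockCode

variable {𝒳 : Type u} {𝒴 : Type v} [Fintype 𝒳] [Fintype 𝒴]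

lemma sum_pi_prod {ι : Type*} [Fintype ι] (n : ℕ) (f : Fin n → ι → ℝ) :
    ∑ y : Fin n → ι, ∏ i, f i (y i) = ∏ i, ∑ a, f i a := by
  classical
  rw [Finset.prod_univ_sum, Fintype.piFinset_univ]

/-- Gallager's bound for block codes of length `n` with `m + 1` messages. -/
lemma exists_blockCode_le (P : 𝒳 → 𝒴 → ℝ) (hP : ∀ x, P x ∈ stdSimplex ℝ 𝒴) (Q : 𝒳 → ℝ)
    (hQ : Q ∈ stdSimplex ℝ 𝒳) (n m : ℕ) {ρ : ℝ} (h0 : 0 ≤ ρ) (h1 : ρ ≤ 1) :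
    ∃ (c : Fin (m + 1) → Fin n → 𝒳) (d : (Fin n → 𝒴) → Fin (m + 1)),
      ∑ w, ∑ y, (if d y ≠ w then ∏ i, P (c w i) (y i) else 0) ≤
        ((m : ℝ) + 1) * ((m : ℝ) ^ ρ *
          (∑ y, (∑ x, Q x * P x y ^ (1 / (1 + ρ))) ^ (1 + ρ)) ^ n) := by
  -- A block of `n` uses is a single use of the product channel; with the product input law the
  -- Gallager sum becomes an `n`-th power.
  obtain ⟨c, d, h⟩ := exists_code_le (fun a : Fin n → 𝒳 => ∏ i, Q (a i))
    ⟨fun a => Finset.prod_nonneg fun i _ => hQ.1 _, sum_prod_eq_one hQ.2 n⟩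
    (fun a (y : Fin n → 𝒴) => ∏ i, P (a i) (y i))
    (fun a y => Finset.prod_nonneg fun i _ => (hP _).1 _) m h0 h1
  refine ⟨c, d, h.trans (le_of_eq ?_)⟩
  congr 2
  have h2 : ∀ y : Fin n → 𝒴,
      (∑ a : Fin n → 𝒳, (∏ i, Q (a i)) * (∏ i, P (a i) (y i)) ^ (1 / (1 + ρ))) ^ (1 + ρ) =
        ∏ i, (∑ x, Q x * P x (y i) ^ (1 / (1 + ρ))) ^ (1 + ρ) := by
    intro y
    rw [Real.finsetProd_rpow _ (fun i => ∑ x, Q x * P x (y i) ^ (1 / (1 + ρ)))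
      fun i _ => Finset.sum_nonneg fun x _ =>
        mul_nonneg (hQ.1 x) (Real.rpow_nonneg ((hP x).1 _) _),
      ← sum_pi_prod n fun i x => Q x * P x (y i) ^ (1 / (1 + ρ))]
    congr 1
    refine Finset.sum_congr rfl fun a _ => ?_
    rw [← Real.finsetProd_rpow _ _ fun i _ => (hP _).1 _, Finset.prod_mul_distrib]
  simp_rw [h2]
  rw [sum_pi_prod n fun _ b => (∑ x, Q x * P x b ^ (1 / (1 + ρ))) ^ (1 + ρ)]
  simp

end BlockCode

/-! ### Properties of the random coding exponent and of `α*`. -/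

section Exponent

lemma channel_le_one {𝒳 : Type u} {𝒴 : Type v} [Fintype 𝒴] {P : 𝒳 → 𝒴 → ℝ}
    (hP : ∀ x, P x ∈ stdSimplex ℝ 𝒴) (x : 𝒳) (y : 𝒴) : P x y ≤ 1 :=
  (hP x).2 ▸ Finset.single_le_sum (f := P x) (fun b _ => (hP x).1 b) (Finset.mem_univ y)
variable {𝒳 : Type u} {𝒴 : Type v} [Fintype 𝒳] [Fintype 𝒴] {P : 𝒳 → 𝒴 → ℝ}

lemma sum_output (hP : ∀ x, P x ∈ stdSimplex ℝ 𝒴) {Q : 𝒳 → ℝ} (hQ : Q ∈ stdSimplex ℝ 𝒳) :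
    ∑ y, ∑ x, Q x * P x y = 1 := by
  rw [Finset.sum_comm]
  simp_rw [← Finset.mul_sum, (hP _).2, mul_one]
  exact hQ.2

/-- Keeps the argument of the logarithm in `gallagerE0` away from zero, so that the supremum
defining `Er` is over a bounded set. By Cauchy–Schwarz the squares of the output probabilities sum
to at least `1 / |𝒴|`. Since probabilities are at most one, passing from exponent `2` to `1 + ρ`
outside and from `1` to `1 / (1 + ρ)` inside only increases the sum. -/
lemma inv_card_le_gallagerSum (hP : ∀ x, P x ∈ stdSimplex ℝ 𝒴) {Q : 𝒳 → ℝ}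
    (hQ : Q ∈ stdSimplex ℝ 𝒳) {ρ : ℝ} (h0 : 0 ≤ ρ) (h1 : ρ ≤ 1) :
    0 < (Fintype.card 𝒴 : ℝ) ∧ (Fintype.card 𝒴 : ℝ)⁻¹ ≤
      ∑ y, (∑ x, Q x * P x y ^ (1 / (1 + ρ))) ^ (1 + ρ) := by
  have hsum := sum_output hP hQ
  have hr0 : ∀ y, 0 ≤ ∑ x, Q x * P x y := fun y =>
    Finset.sum_nonneg fun x _ => mul_nonneg (hQ.1 x) ((hP x).1 y)
  have hr1 : ∀ y, ∑ x, Q x * P x y ≤ 1 := fun y => by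
    rw [← hsum]
    exact Finset.single_le_sum (f := fun y => ∑ x, Q x * P x y) (fun b _ => hr0 b)
      (Finset.mem_univ y)
  have hcard : 0 < (Fintype.card 𝒴 : ℝ) := by
    rw [Nat.cast_pos, Fintype.card_pos_iff]
    by_contra h
    rw [not_nonempty_iff] at h
    simp at hsum
  refine ⟨hcard, ?_⟩
  have h2 := sq_sum_le_card_mul_sum_sq (s := Finset.univ) (f := fun y => ∑ x, Q x * P x y)
  rw [hsum, Finset.card_univ] at h2
  rw [inv_le_iff_one_le_mul₀' hcard]
  refine (by simpa using h2 : (1 : ℝ) ≤ _).trans ?_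
  gcongr with y
  have hs : 1 / (1 + ρ) ≤ 1 := by
    rw [div_le_one (by linarith)]
    linarith
  calc (∑ x, Q x * P x y) ^ 2 = (∑ x, Q x * P x y) ^ (2 : ℝ) := by norm_cast
    _ ≤ (∑ x, Q x * P x y) ^ (1 + ρ) :=
      Real.rpow_le_rpow_of_exponent_ge_of_imp (hr0 y) (hr1 y) (by linarith) (by
        intro _ h
        linarith)
    _ ≤ _ := by
      refine Real.rpow_le_rpow (hr0 y) (Finset.sum_le_sum fun x _ => ?_) (by linarith)
      refine mul_le_mul_of_nonneg_left ?_ (hQ.1 x)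
      rcases ((hP x).1 y).eq_or_lt with h | h
      · rw [← h]
        exact Real.rpow_nonneg le_rfl _
      · nth_rewrite 1 [← Real.rpow_one (P x y)]
        exact Real.rpow_le_rpow_of_exponent_ge h (channel_le_one hP x y) hs

lemma gallagerSum_eq (hP : ∀ x, P x ∈ stdSimplex ℝ 𝒴) {Q : 𝒳 → ℝ}
    (hQ : Q ∈ stdSimplex ℝ 𝒳) {ρ : ℝ} (h0 : 0 ≤ ρ) (h1 : ρ ≤ 1) :
    ∑ y, (∑ x, Q x * P x y ^ (1 / (1 + ρ))) ^ (1 + ρ) = (2 : ℝ) ^ (-gallagerE0 P ρ Q) := by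
  obtain ⟨hc, h⟩ := inv_card_le_gallagerSum hP hQ h0 h1
  rw [gallagerE0, neg_neg, Real.rpow_logb two_pos (by norm_num)]
  exact (inv_pos.2 hc).trans_le h

lemma gallagerE0_le (hP : ∀ x, P x ∈ stdSimplex ℝ 𝒴) {Q : 𝒳 → ℝ}
    (hQ : Q ∈ stdSimplex ℝ 𝒳) {ρ : ℝ} (h0 : 0 ≤ ρ) (h1 : ρ ≤ 1) :
    gallagerE0 P ρ Q ≤ Real.logb 2 (Fintype.card 𝒴) := by
  obtain ⟨hc, h⟩ := inv_card_le_gallagerSum hP hQ h0 h1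
  rw [gallagerE0, neg_le, ← Real.logb_inv]
  exact Real.logb_le_logb_of_le (by norm_num) (inv_pos.2 hc) h

lemma bddAbove_Er (hP : ∀ x, P x ∈ stdSimplex ℝ 𝒴) (R : ℝ) :
    BddAbove ((fun s : ℝ × (𝒳 → ℝ) => gallagerE0 P s.1 s.2 - s.1 * R) ''
      (Set.Icc (0 : ℝ) 1 ×ˢ stdSimplex ℝ 𝒳)) := by
  refine ⟨Real.logb 2 (Fintype.card 𝒴) + |R|, ?_⟩
  rintro _ ⟨⟨ρ, Q⟩, ⟨⟨h0, h1⟩, hQ⟩, rfl⟩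
  have h := gallagerE0_le hP hQ h0 h1
  have h2 : -(ρ * R) ≤ |R| := by
    calc -(ρ * R) ≤ |ρ * R| := neg_le_abs _
      _ = ρ * |R| := by rw [abs_mul, abs_of_nonneg h0]
      _ ≤ |R| := mul_le_of_le_one_left (abs_nonneg R) h1
  simp only at *
  linarith

lemma le_Er (hP : ∀ x, P x ∈ stdSimplex ℝ 𝒴) {Q : 𝒳 → ℝ} (hQ : Q ∈ stdSimplex ℝ 𝒳) {ρ : ℝ}
    (h0 : 0 ≤ ρ) (h1 : ρ ≤ 1) (R : ℝ) : gallagerE0 P ρ Q - ρ * R ≤ Er P R :=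
  le_csSup (bddAbove_Er hP R) ⟨(ρ, Q), ⟨⟨h0, h1⟩, hQ⟩, rfl⟩

lemma nonempty_Er [Nonempty 𝒳] (R : ℝ) :
    ((fun s : ℝ × (𝒳 → ℝ) => gallagerE0 P s.1 s.2 - s.1 * R) ''
      (Set.Icc (0 : ℝ) 1 ×ˢ stdSimplex ℝ 𝒳)).Nonempty := by
  classical
  exact ⟨_, (0, Pi.single (Classical.arbitrary 𝒳) 1),
    ⟨⟨le_rfl, zero_le_one⟩, single_mem_stdSimplex ℝ _⟩, rfl⟩

lemma exists_lt_of_lt_Er [Nonempty 𝒳] {R c : ℝ} (hc : c < Er P R) :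
    ∃ (ρ : ℝ) (Q : 𝒳 → ℝ), 0 ≤ ρ ∧ ρ ≤ 1 ∧ Q ∈ stdSimplex ℝ 𝒳 ∧
      c < gallagerE0 P ρ Q - ρ * R := by
  obtain ⟨_, ⟨⟨ρ, Q⟩, ⟨⟨h0, h1⟩, hQ⟩, rfl⟩, h⟩ := exists_lt_of_lt_csSup (nonempty_Er R) hc
  exact ⟨ρ, Q, h0, h1, hQ, h⟩

lemma Er_le [Nonempty 𝒳] {R c : ℝ} (h : ∀ (ρ : ℝ) (Q : 𝒳 → ℝ), 0 ≤ ρ → ρ ≤ 1 →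
    Q ∈ stdSimplex ℝ 𝒳 → gallagerE0 P ρ Q - ρ * R ≤ c) : Er P R ≤ c := by
  refine csSup_le (nonempty_Er R) ?_
  rintro _ ⟨⟨ρ, Q⟩, ⟨⟨h0, h1⟩, hQ⟩, rfl⟩
  exact h ρ Q h0 h1 hQ

lemma gallagerE0_zero (hP : ∀ x, P x ∈ stdSimplex ℝ 𝒴) {Q : 𝒳 → ℝ} (hQ : Q ∈ stdSimplex ℝ 𝒳) :
    gallagerE0 P 0 Q = 0 := by
  simp [gallagerE0, sum_output hP hQ]

lemma Er_nonneg [Nonempty 𝒳] (hP : ∀ x, P x ∈ stdSimplex ℝ 𝒴) (R : ℝ) : 0 ≤ Er P R := by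
  classical
  have hQ := single_mem_stdSimplex ℝ (Classical.arbitrary 𝒳)
  have h := le_Er hP hQ le_rfl zero_le_one R
  rwa [gallagerE0_zero hP hQ, zero_mul, sub_zero] at h

lemma Er_antitone [Nonempty 𝒳] (hP : ∀ x, P x ∈ stdSimplex ℝ 𝒴) : Antitone (Er P) :=
  fun a _ hab => Er_le fun _ _ h0 h1 hQ =>
    (sub_le_sub_left (mul_le_mul_of_nonneg_left hab h0) _).trans (le_Er hP hQ h0 h1 a)

/-- A supremum of affine functions of the rate with slopes `-ρ` in `[-1, 0]` is 1-Lipschitz. -/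
lemma Er_continuous [Nonempty 𝒳] (hP : ∀ x, P x ∈ stdSimplex ℝ 𝒴) : Continuous (Er P) := by
  refine LipschitzWith.continuous (K := 1) (LipschitzWith.of_le_add fun a b => ?_)
  refine Er_le fun ρ Q h0 h1 hQ => ?_
  have h := le_Er hP hQ h0 h1 b
  have h2 : ρ * (b - a) ≤ dist a b := by
    calc ρ * (b - a) ≤ ρ * |b - a| := mul_le_mul_of_nonneg_left (le_abs_self _) h0
      _ ≤ |b - a| := mul_le_of_le_one_left (abs_nonneg _) h1
      _ = dist a b := by rw [dist_comm, Real.dist_eq]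
  linarith

/-- The formula covers `p = 0` too: near `ρ = 0` the exponent is nonzero, so the power vanishes
identically, in agreement with `0 * log 0 = 0`. -/
lemma hasDerivAt_rpow_inv {p : ℝ} (hp : 0 ≤ p) :
    HasDerivAt (fun ρ : ℝ => p ^ (1 / (1 + ρ))) (-(p * Real.log p)) 0 := by
  rcases hp.eq_or_lt with rfl | hp
  · have h : (fun ρ : ℝ => (0 : ℝ) ^ (1 / (1 + ρ))) =ᶠ[nhds 0] fun _ => 0 := by
      filter_upwards [lt_mem_nhds (show (-1 : ℝ) < 0 by norm_num)] with ρ hρ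
      exact Real.zero_rpow (one_div_ne_zero (by linarith))
    simpa using (hasDerivAt_const (0 : ℝ) (0 : ℝ)).congr_of_eventuallyEq h
  · have h : HasDerivAt (fun ρ : ℝ => 1 / (1 + ρ)) (-1) 0 := by
      have := ((hasDerivAt_id (0 : ℝ)).const_add 1).fun_inv (by simp)
      simpa [one_div] using this
    convert h.const_rpow hp using 1
    simp
    ring

lemma hasDerivAt_gallagerTerm (hP : ∀ x, P x ∈ stdSimplex ℝ 𝒴) {Q : 𝒳 → ℝ}
    (hQ : Q ∈ stdSimplex ℝ 𝒳) (y : 𝒴) :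
    HasDerivAt (fun ρ : ℝ => (∑ x, Q x * P x y ^ (1 / (1 + ρ))) ^ (1 + ρ))
      (∑ x, Q x * P x y * (Real.log (∑ a, Q a * P a y) - Real.log (P x y))) 0 := by
  have hnn : ∀ x, 0 ≤ Q x * P x y := fun x => mul_nonneg (hQ.1 x) ((hP x).1 y)
  rcases (Finset.sum_nonneg fun x (_ : x ∈ Finset.univ) => hnn x).eq_or_lt with h | h
  · have hz : ∀ x, Q x * P x y = 0 := fun x =>
      (Finset.sum_eq_zero_iff_of_nonneg fun x _ => hnn x).1 h.symm x (Finset.mem_univ x)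
    have he : (fun ρ : ℝ => (∑ x, Q x * P x y ^ (1 / (1 + ρ))) ^ (1 + ρ)) =ᶠ[nhds 0]
        fun _ => 0 := by
      filter_upwards [lt_mem_nhds (show (-1 : ℝ) < 0 by norm_num)] with ρ hρ
      rw [Finset.sum_eq_zero, Real.zero_rpow (by linarith)]
      intro x _
      rcases mul_eq_zero.1 (hz x) with hx | hx
      · rw [hx, zero_mul]
      · rw [hx, Real.zero_rpow (one_div_ne_zero (by linarith)), mul_zero]
    simpa [hz] using (hasDerivAt_const (0 : ℝ) (0 : ℝ)).congr_of_eventuallyEq he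
  · have h1 : HasDerivAt (fun ρ : ℝ => ∑ x, Q x * P x y ^ (1 / (1 + ρ)))
        (∑ x, Q x * -(P x y * Real.log (P x y))) 0 :=
      HasDerivAt.fun_sum fun x _ => (hasDerivAt_rpow_inv ((hP x).1 y)).const_mul (Q x)
    have h2 : HasDerivAt (fun ρ : ℝ => 1 + ρ) 1 0 := (hasDerivAt_id (0 : ℝ)).const_add 1
    convert h1.rpow h2 (by simpa using h) using 1
    simp only [add_zero, div_one, Real.rpow_one, sub_self, Real.rpow_zero, mul_one, one_mul]
    rw [Finset.sum_mul, ← Finset.sum_add_distrib]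
    exact Finset.sum_congr rfl fun x _ => by ring

/-- This is the link between `Er` and capacity: to first order in `ρ`, the objective `E₀(ρ, Q) - ρ
R` is `ρ` times mutual information minus rate. -/
lemma hasDerivAt_gallagerE0 (hP : ∀ x, P x ∈ stdSimplex ℝ 𝒴) {Q : 𝒳 → ℝ}
    (hQ : Q ∈ stdSimplex ℝ 𝒳) :
    HasDerivAt (fun ρ => gallagerE0 P ρ Q) (mutualInfo P Q) 0 := by
  have h1 := HasDerivAt.fun_sum fun y (_ : y ∈ Finset.univ) => hasDerivAt_gallagerTerm hP hQ y
  have hG : ∑ y, (∑ x, Q x * P x y ^ (1 / (1 + (0 : ℝ)))) ^ (1 + (0 : ℝ)) = 1 := by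
    simp [sum_output hP hQ]
  have h2 := ((h1.log (by rw [hG]; exact one_ne_zero)).div_const (Real.log 2)).neg
  simp only [hG, div_one] at h2
  refine h2.congr_deriv (Eq.symm ?_)
  rw [mutualInfo, Finset.sum_comm, Finset.sum_div, ← Finset.sum_neg_distrib]
  refine Finset.sum_congr rfl fun y _ => ?_
  rw [Finset.sum_div, ← Finset.sum_neg_distrib]
  refine Finset.sum_congr rfl fun x _ => ?_
  by_cases hx : Q x * P x y = 0
  · simp [hx]
  · have hnn : ∀ a, 0 ≤ Q a * P a y := fun a => mul_nonneg (hQ.1 a) ((hP a).1 y)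
    have hq : (∑ a, Q a * P a y) ≠ 0 := fun h0 =>
      hx ((Finset.sum_eq_zero_iff_of_nonneg fun a _ => hnn a).1 h0 x (Finset.mem_univ x))
    rw [Real.logb, Real.log_div (right_ne_zero_of_mul hx) hq]
    ring

/-- The random coding exponent is positive below capacity. -/
lemma Er_pos (hP : ∀ x, P x ∈ stdSimplex ℝ 𝒴) [Nonempty 𝒳] {R : ℝ} (hR : R < capacity P) :
    0 < Er P R := by
  classical
  obtain ⟨_, ⟨Q, hQ, rfl⟩, hI⟩ := exists_lt_of_lt_csSup
    (Set.Nonempty.image _ ⟨_, single_mem_stdSimplex ℝ (Classical.arbitrary 𝒳)⟩) hR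
  have h' := (hasDerivAt_iff_tendsto_slope.1 (hasDerivAt_gallagerE0 hP hQ)).mono_left
    (nhdsGT_le_nhdsNE (0 : ℝ))
  -- For small `ρ > 0` the slope of `E₀(·, Q)` from `0`, where it vanishes, still exceeds `R`.
  obtain ⟨ρ, hs, h0, h1⟩ := ((h'.eventually_const_lt hI).and
    (Ioc_mem_nhdsGT (zero_lt_one (α := ℝ)))).exists
  rw [slope_def_field, gallagerE0_zero hP hQ, sub_zero, sub_zero, lt_div_iff₀ h0] at hs
  have := le_Er hP hQ h0.le h1 R
  linarith

/-- The numerator of `g` is antitone and the denominator increases; positivity at the left point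
makes the decrease strict. Where `Er` vanishes, `g` is constant, hence the condition. -/
lemma g_lt_of_lt [Nonempty 𝒳] (hP : ∀ x, P x ∈ stdSimplex ℝ 𝒴) {a b : ℝ} (ha : 0 < a)
    (hab : a < b) (hg : 0 < g P a) : g P b < g P a := by
  have h : 0 < Er P a := by
    have := mul_pos hg ha
    rwa [g, div_mul_cancel₀ _ ha.ne'] at this
  calc Er P b / b ≤ Er P a / b := by
        have := Er_antitone hP hab.le
        have := ha.trans hab
        gcongr
    _ < Er P a / a := div_lt_div_of_pos_left h ha hab

lemma existsUnique_g_eq [Nonempty 𝒳] (hP : ∀ x, P x ∈ stdSimplex ℝ 𝒴) {R γ : ℝ} (hR : 0 < R)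
    (hγ : 0 < γ) (hγE : γ < Er P R) : ∃! a : ℝ, 0 < a ∧ g P a = γ / R := by
  have hpos : 0 < γ / R := div_pos hγ hR
  obtain ⟨b, hb, hgb⟩ : ∃ b, R ≤ b ∧ g P b ≤ γ / R := by
    -- Chosen so that `Er P R` divided by it is `γ / R`; since it is at least `R`, monotonicity
    -- bounds the numerator of `g` by `Er P R`.
    refine ⟨R * Er P R / γ, ?_, ?_⟩
    · rw [le_div_iff₀ hγ]
      exact mul_le_mul_of_nonneg_left hγE.le hR.le
    · have hE : 0 < Er P R := hγ.trans hγE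
      have hle : R ≤ R * Er P R / γ := by
        rw [le_div_iff₀ hγ]
        exact mul_le_mul_of_nonneg_left hγE.le hR.le
      calc g P (R * Er P R / γ) ≤ Er P R / (R * Er P R / γ) := by
            rw [g]
            have := Er_antitone hP hle
            gcongr
        _ = γ / R := by field_simp
  have hcont : ContinuousOn (g P) (Set.Icc R b) :=
    (Er_continuous hP).continuousOn.div continuousOn_id fun a ha => (hR.trans_le ha.1).ne'
  have hgR : γ / R ≤ g P R := by
    rw [g]
    gcongr
  obtain ⟨a, ha, hga⟩ := intermediate_value_Icc' hb hcont ⟨hgb, hgR⟩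
  refine ⟨a, ⟨hR.trans_le ha.1, hga⟩, ?_⟩
  rintro c ⟨hc, hgc⟩
  rcases lt_trichotomy c a with h | h | h
  · have := g_lt_of_lt hP hc h (hgc ▸ hpos)
    rw [hgc, hga] at this
    exact absurd this (lt_irrefl _)
  · exact h
  · have := g_lt_of_lt hP (hR.trans_le ha.1) h (hga ▸ hpos)
    rw [hgc, hga] at this
    exact absurd this (lt_irrefl _)

/-- Since `α * Er P (R / α) = R * g P (R / α)`, the inequality says that `g` at `R / α` exceeds `γ /
R`. For `α > α*` the point `R / α` lies left of the solution of `g = γ / R`, and `g` decreases where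
it is positive. At `α*` itself there is only equality. -/
lemma alphaStar_spec [Nonempty 𝒳] (hP : ∀ x, P x ∈ stdSimplex ℝ 𝒴) {R γ : ℝ} (hR : 0 < R)
    (hγ : 0 < γ) (hγE : γ < Er P R) :
    0 < alphaStar P R γ ∧ ∀ α, alphaStar P R γ < α → γ < α * Er P (R / α) := by
  obtain ⟨a, ⟨ha, hga⟩, huniq⟩ := existsUnique_g_eq hP hR hγ hγE
  have hex : ∃ a ∈ Set.Ioi (0 : ℝ), g P a = γ / R := ⟨a, ha, hga⟩
  have h1 : 0 < Function.invFunOn (g P) (Set.Ioi 0) (γ / R) := Function.invFunOn_mem hex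
  have h2 := Function.invFunOn_eq hex
  have hs : 0 < alphaStar P R γ := div_pos hR h1
  refine ⟨hs, fun α hα => ?_⟩
  have hα0 : 0 < α := hs.trans hα
  have hlt : R / α < Function.invFunOn (g P) (Set.Ioi 0) (γ / R) := by
    rw [alphaStar, div_lt_iff₀ h1] at hα
    rw [div_lt_iff₀ hα0]
    linarith
  have hg : γ / R < g P (R / α) := by
    by_contra hcon
    push Not at hcon
    rcases hcon.lt_or_eq with h | h
    · by_cases hp : 0 < g P (R / α)
      · have := g_lt_of_lt hP (div_pos hR hα0) hlt hp
        rw [h2] at this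
        linarith
      · have hle : Er P (R / α) ≤ 0 := by
          by_contra hE
          push Not at hE
          exact hp (div_pos hE (div_pos hR hα0))
        have h3 : Er P (Function.invFunOn (g P) (Set.Ioi 0) (γ / R)) ≤ 0 :=
          (Er_antitone hP hlt.le).trans hle
        have h4 := div_nonpos_of_nonpos_of_nonneg h3 h1.le
        have h5 := div_pos hγ hR
        change g P _ ≤ 0 at h4
        linarith
    · have := huniq _ ⟨div_pos hR hα0, h⟩
      have h6 := huniq _ ⟨h1, h2⟩
      rw [this, h6] at hlt
      exact lt_irrefl _ hlt
  rw [g, div_lt_div_iff₀ hR (div_pos hR hα0)] at hg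
  have h7 : γ * (R / α) * α = γ * R := by field_simp
  nlinarith

end Exponent

/-! ### Construction of feedback schemes from independent channel answers. -/

section Scheme

/-- The outputs generated by the encoder `e`, when `V (n, x)` is what the channel returns in the
`(n+1)`-st use on the input `x`. -/
def runOut {𝒳 : Type u} {𝒴 : Type v} (e : (n : ℕ) → (Fin n → 𝒴) → 𝒳) (V : ℕ × 𝒳 → 𝒴) : ℕ → 𝒴
  | n => V (n, e n fun i : Fin n => runOut e V i)
termination_by n => n
decreasing_by exact i.2

/-- Once a whole output word is prescribed, the inputs it provokes are determined, so the recursive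
event becomes a cylinder in the table `V`. -/
lemma forall_runOut_eq_iff {𝒳 : Type u} {𝒴 : Type v} (e : (n : ℕ) → (Fin n → 𝒴) → 𝒳)
    (V : ℕ × 𝒳 → 𝒴) (n : ℕ) (z : ℕ → 𝒴) :
    (∀ i < n, runOut e V i = z i) ↔ ∀ i < n, V (i, e i fun j : Fin i => z j) = z i := by
  constructor
  · intro h i hi
    rw [← h i hi, runOut]
    congr 3
    funext j
    exact (h j (j.2.trans hi)).symm
  · intro h i
    induction i using Nat.strong_induction_on with
    | _ i ih =>
      intro hi
      rw [← h i hi, runOut]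
      congr 3
      funext j
      exact ih j j.2 (j.2.trans hi)

variable {𝒳 : Type u} {𝒴 : Type v} [Fintype 𝒴] [MeasurableSpace 𝒴]

/-- The law of the channel output on the input `x`. -/
noncomputable def outLaw (P : 𝒳 → 𝒴 → ℝ) (x : 𝒳) : Measure 𝒴 :=
  ∑ y, ENNReal.ofReal (P x y) • Measure.dirac y

lemma outLaw_singleton [DiscreteMeasurableSpace 𝒴] (P : 𝒳 → 𝒴 → ℝ) (x : 𝒳) (b : 𝒴) :
    outLaw P x {b} = ENNReal.ofReal (P x b) := by
  classical
  simp [outLaw, Measure.finsetSum_apply, Set.indicator_apply]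

lemma isProbabilityMeasure_outLaw {P : 𝒳 → 𝒴 → ℝ} (hP : ∀ x, P x ∈ stdSimplex ℝ 𝒴) (x : 𝒳) :
    IsProbabilityMeasure (outLaw P x) := by
  constructor
  simp only [outLaw, Measure.finsetSum_apply, Measure.smul_apply, measure_univ, smul_eq_mul,
    mul_one]
  rw [← ENNReal.ofReal_sum_of_nonneg fun y _ => (hP x).1 y, (hP x).2, ENNReal.ofReal_one]

lemma measurableSet_filtration [MeasurableSpace 𝒳] [DiscreteMeasurableSpace 𝒴]
    {P : 𝒳 → 𝒴 → ℝ} {M : ℕ} (S : FeedbackScheme P M) {m n : ℕ}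
    (h : m ≤ n) (T : (Fin m → 𝒴) → Prop) :
    MeasurableSet[S.filtration n] {ω | T fun i => S.out i ω} :=
  S.filtration.mono h _ ⟨{p | T p.2}, measurable_snd (MeasurableSet.of_discrete (s := {y | T y})),
    rfl⟩

/-- The joint law of the answers of the channel to all inputs at all times. -/
noncomputable def noise (P : 𝒳 → 𝒴 → ℝ) (hP : ∀ x, P x ∈ stdSimplex ℝ 𝒴) :
    Measure (ℕ × 𝒳 → 𝒴) :=
  haveI := isProbabilityMeasure_outLaw hP
  Measure.infinitePi fun k => outLaw P k.2

instance isProbabilityMeasure_noise (P : 𝒳 → 𝒴 → ℝ) (hP : ∀ x, P x ∈ stdSimplex ℝ 𝒴) :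
    IsProbabilityMeasure (noise P hP) := by
  have := isProbabilityMeasure_outLaw hP
  unfold noise
  infer_instance

variable [DiscreteMeasurableSpace 𝒴]

/-- The cylinder constrains one coordinate per time, and different times use different coordinates
whatever the inputs are, so independence gives a product. -/
lemma noise_runOut {P : 𝒳 → 𝒴 → ℝ} (hP : ∀ x, P x ∈ stdSimplex ℝ 𝒴)
    (e : (n : ℕ) → (Fin n → 𝒴) → 𝒳) (n : ℕ) (z : ℕ → 𝒴) :
    (noise P hP).real {V | ∀ i < n, runOut e V i = z i} =
      ∏ i ∈ Finset.range n, P (e i fun j : Fin i => z j) (z i) := by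
  have := isProbabilityMeasure_outLaw hP
  have hset : {V : ℕ × 𝒳 → 𝒴 | ∀ i < n, runOut e V i = z i} =
      Set.pi ((Finset.range n).map ⟨fun i => (i, e i fun j : Fin i => z j),
        fun a b h => congrArg Prod.fst h⟩ : Finset (ℕ × 𝒳)) (fun k => {z k.1}) := by
    ext V
    rw [Set.mem_ofPred_eq, forall_runOut_eq_iff]
    simp only [Set.mem_pi, Finset.mem_coe, Finset.mem_map, Finset.mem_range,
      Set.mem_singleton_iff]
    constructor
    · rintro h _ ⟨i, hi, rfl⟩
      exact h i hi
    · intro h i hi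
      exact h _ ⟨i, hi, rfl⟩
  rw [hset, Measure.real, noise, Measure.infinitePi_pi _ fun _ _ => MeasurableSet.of_discrete,
    Finset.prod_map, ENNReal.toReal_prod]
  refine Finset.prod_congr rfl fun i _ => ?_
  simp [outLaw_singleton, ENNReal.toReal_ofReal ((hP _).1 _)]
  rfl

/-- The law of an equiprobable message and the channel answers. -/
noncomputable def jointLaw (P : 𝒳 → 𝒴 → ℝ) (hP : ∀ x, P x ∈ stdSimplex ℝ 𝒴) (M : ℕ) [NeZero M] :
    Measure (Fin M × (ℕ × 𝒳 → 𝒴)) :=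
  (PMF.uniformOfFintype (Fin M)).toMeasure.prod (noise P hP)

instance isProbabilityMeasure_jointLaw (P : 𝒳 → 𝒴 → ℝ) (hP : ∀ x, P x ∈ stdSimplex ℝ 𝒴) (M : ℕ)
    [NeZero M] : IsProbabilityMeasure (jointLaw P hP M) := by
  unfold jointLaw
  infer_instance

lemma jointLaw_real {P : 𝒳 → 𝒴 → ℝ} (hP : ∀ x, P x ∈ stdSimplex ℝ 𝒴) {M : ℕ} [NeZero M]
    (e : (n : ℕ) → Fin M → (Fin n → 𝒴) → 𝒳) (w : Fin M) (n : ℕ) (z : ℕ → 𝒴) :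
    (jointLaw P hP M).real {ω | ω.1 = w ∧ ∀ i < n, runOut (fun k => e k ω.1) ω.2 i = z i} =
      1 / (M : ℝ) * ∏ i ∈ Finset.range n, P (e i w fun j : Fin i => z j) (z i) := by
  have hset : {ω : Fin M × (ℕ × 𝒳 → 𝒴) |
      ω.1 = w ∧ ∀ i < n, runOut (fun k => e k ω.1) ω.2 i = z i} =
      {w} ×ˢ {V | ∀ i < n, runOut (fun k => e k w) V i = z i} := by
    ext ⟨a, V⟩
    simp only [Set.mem_ofPred_eq, Set.mem_prod, Set.mem_singleton_iff]
    constructor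
    · rintro ⟨rfl, h⟩
      exact ⟨rfl, h⟩
    · rintro ⟨rfl, h⟩
      exact ⟨rfl, h⟩
  rw [hset, jointLaw, measureReal_prod_prod, noise_runOut hP, Measure.real,
    PMF.toMeasure_apply_singleton _ _ (measurableSet_singleton w)]
  simp

variable [Fintype 𝒳] [MeasurableSpace 𝒳] [DiscreteMeasurableSpace 𝒳]

lemma measurable_runOut {M : ℕ} (e : (n : ℕ) → Fin M → (Fin n → 𝒴) → 𝒳) (n : ℕ) :
    Measurable fun ω : Fin M × (ℕ × 𝒳 → 𝒴) => runOut (fun k => e k ω.1) ω.2 n := by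
  induction n using Nat.strong_induction_on with
  | _ n ih =>
    have h1 : Measurable fun ω : Fin M × (ℕ × 𝒳 → 𝒴) =>
        (fun i : Fin n => runOut (fun k => e k ω.1) ω.2 i) :=
      measurable_pi_lambda _ fun i => ih i i.2
    have h2 : Measurable fun ω : Fin M × (ℕ × 𝒳 → 𝒴) =>
        e n ω.1 (fun i : Fin n => runOut (fun k => e k ω.1) ω.2 i) :=
      (Measurable.of_discrete (f := fun p : Fin M × (Fin n → 𝒴) => e n p.1 p.2)).comp
        (measurable_fst.prodMk h1)
    have h3 : Measurable fun p : (ℕ × 𝒳 → 𝒴) × 𝒳 => p.1 (n, p.2) :=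
      measurable_from_prod_countable_left fun x => measurable_pi_apply (n, x)
    have h4 := h3.comp (measurable_snd.prodMk h2)
    convert h4 using 2 with ω
    simp only [Function.comp]
    rw [runOut]

/-- The scheme without common randomness that has the encoders `e` and the decoders `dc`. -/
noncomputable def detScheme {P : 𝒳 → 𝒴 → ℝ} (hP : ∀ x, P x ∈ stdSimplex ℝ 𝒴) {M : ℕ} [NeZero M]
    (e : (n : ℕ) → Fin M → (Fin n → 𝒴) → 𝒳) (dc : (n : ℕ) → (Fin n → 𝒴) → Fin M) :
    FeedbackScheme P M where
  𝒰 := PUnit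
  Ω := Fin M × (ℕ × 𝒳 → 𝒴)
  μ := jointLaw P hP M
  U _ := PUnit.unit
  measurable_U := measurable_const
  msg := Prod.fst
  measurable_msg := measurable_fst
  out n ω := runOut (fun k => e k ω.1) ω.2 n
  measurable_out := measurable_runOut e
  enc n _ w y := e n w y
  measurable_enc _ _ _ := measurable_const
  dec n _ y := dc n y
  measurable_dec _ _ := measurable_const
  msg_uniform w := by
    -- An empty output alphabet would force an empty input alphabet, but the encoder at time `0`
    -- produces an input.
    have h : Nonempty 𝒴 := by
      by_contra h
      rw [not_nonempty_iff] at h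
      have hX : IsEmpty 𝒳 := ⟨fun x => by simpa using (hP x).2⟩
      exact hX.false (e 0 w finZeroElim)
    simpa using jointLaw_real hP e w 0 fun _ => Classical.arbitrary 𝒴
  indep := indepFun_const_left _ _
  memoryless n A _ w y x b := by
    by_cases hA : PUnit.unit ∈ A
    swap
    · simp [hA]
    by_cases hx : e n w y = x
    swap
    · have h0 : ∀ ω : Fin M × (ℕ × 𝒳 → 𝒴), ¬ (ω.1 = w ∧
          (fun i : Fin n => runOut (fun k => e k ω.1) ω.2 i) = y ∧
          e n ω.1 (fun i : Fin n => runOut (fun k => e k ω.1) ω.2 i) = x) := by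
        rintro ω ⟨h1, h2, h3⟩
        rw [h2, h1] at h3
        exact hx h3
      have h1 : {ω : Fin M × (ℕ × 𝒳 → 𝒴) | PUnit.unit ∈ A ∧ ω.1 = w ∧
          (fun i : Fin n => runOut (fun k => e k ω.1) ω.2 i) = y ∧
          e n ω.1 (fun i : Fin n => runOut (fun k => e k ω.1) ω.2 i) = x} = ∅ :=
        Set.eq_empty_of_forall_notMem fun ω h => h0 ω h.2
      have h2 : {ω : Fin M × (ℕ × 𝒳 → 𝒴) | PUnit.unit ∈ A ∧ ω.1 = w ∧
          (fun i : Fin n => runOut (fun k => e k ω.1) ω.2 i) = y ∧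
          e n ω.1 (fun i : Fin n => runOut (fun k => e k ω.1) ω.2 i) = x ∧
          runOut (fun k => e k ω.1) ω.2 n = b} = ∅ :=
        Set.eq_empty_of_forall_notMem fun ω h => h0 ω ⟨h.2.1, h.2.2.1, h.2.2.2.1⟩
      rw [h1, h2]
      simp
    -- Prolonging the past `y` by `b` turns the event with the next output into a prefix event of
    -- length `n + 1`; its probability has exactly the extra factor `P x b`.
    let z : ℕ → 𝒴 := fun k => if h : k < n then y ⟨k, h⟩ else b
    have hzy : (fun j : Fin n => z j) = y := by
      funext j
      simp [z]
    have hzn : z n = b := by simp [z]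
    have hpast : ∀ ω : Fin M × (ℕ × 𝒳 → 𝒴),
        (fun i : Fin n => runOut (fun k => e k ω.1) ω.2 i) = y ↔
          ∀ i < n, runOut (fun k => e k ω.1) ω.2 i = z i := by
      intro ω
      rw [← hzy]
      exact ⟨fun h i hi => congrFun h ⟨i, hi⟩, fun h => funext fun j => h j j.2⟩
    have h1 : {ω : Fin M × (ℕ × 𝒳 → 𝒴) | PUnit.unit ∈ A ∧ ω.1 = w ∧
        (fun i : Fin n => runOut (fun k => e k ω.1) ω.2 i) = y ∧
        e n ω.1 (fun i : Fin n => runOut (fun k => e k ω.1) ω.2 i) = x} =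
        {ω | ω.1 = w ∧ ∀ i < n, runOut (fun k => e k ω.1) ω.2 i = z i} := by
      ext ω
      simp only [Set.mem_ofPred_eq]
      constructor
      · rintro ⟨-, h1, h2, -⟩
        exact ⟨h1, (hpast ω).1 h2⟩
      · rintro ⟨h1, h2⟩
        have h3 := (hpast ω).2 h2
        exact ⟨hA, h1, h3, by rw [h3, h1, hx]⟩
    have h2 : {ω : Fin M × (ℕ × 𝒳 → 𝒴) | PUnit.unit ∈ A ∧ ω.1 = w ∧
        (fun i : Fin n => runOut (fun k => e k ω.1) ω.2 i) = y ∧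
        e n ω.1 (fun i : Fin n => runOut (fun k => e k ω.1) ω.2 i) = x ∧
        runOut (fun k => e k ω.1) ω.2 n = b} =
        {ω | ω.1 = w ∧ ∀ i < n + 1, runOut (fun k => e k ω.1) ω.2 i = z i} := by
      ext ω
      simp only [Set.mem_ofPred_eq, Nat.forall_lt_succ_right, hzn]
      constructor
      · rintro ⟨-, h1, h2, -, h4⟩
        exact ⟨h1, (hpast ω).1 h2, h4⟩
      · rintro ⟨h1, h2, h4⟩
        have h3 := (hpast ω).2 h2
        exact ⟨hA, h1, h3, by rw [h3, h1, hx], h4⟩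
    rw [h1, h2, jointLaw_real hP, jointLaw_real hP, Finset.prod_range_succ, hzy, hx, hzn]
    ring

/-- The probability of an event that is determined by the message and the first `n` outputs. -/
lemma jointLaw_real_event {P : 𝒳 → 𝒴 → ℝ} (hP : ∀ x, P x ∈ stdSimplex ℝ 𝒴) {M : ℕ} [NeZero M]
    (e : (n : ℕ) → Fin M → (Fin n → 𝒴) → 𝒳) (n : ℕ) (T : Fin M → (Fin n → 𝒴) → Prop)
    [∀ w y, Decidable (T w y)] :
    (jointLaw P hP M).real
        {ω | T ω.1 fun i : Fin n => runOut (fun k => e k ω.1) ω.2 i} =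
      1 / (M : ℝ) * ∑ w, ∑ y : Fin n → 𝒴, if T w y then
        ∏ i : Fin n, P (e i w fun j : Fin i => y ⟨j, j.2.trans i.2⟩) (y i) else 0 := by
  classical
  have hmeas : Measurable fun ω : Fin M × (ℕ × 𝒳 → 𝒴) =>
      (ω.1, fun i : Fin n => runOut (fun k => e k ω.1) ω.2 i) :=
    measurable_fst.prodMk (measurable_pi_lambda _ fun i => measurable_runOut e i)
  have h1 := sum_measureReal_preimage_singleton (μ := jointLaw P hP M)
    (Finset.univ.filter fun p : Fin M × (Fin n → 𝒴) => T p.1 p.2)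
    (f := fun ω : Fin M × (ℕ × 𝒳 → 𝒴) =>
      (ω.1, fun i : Fin n => runOut (fun k => e k ω.1) ω.2 i))
    (fun p _ => hmeas (measurableSet_singleton p))
  have h2 : (fun ω : Fin M × (ℕ × 𝒳 → 𝒴) =>
      (ω.1, fun i : Fin n => runOut (fun k => e k ω.1) ω.2 i)) ⁻¹'
        ((Finset.univ.filter fun p : Fin M × (Fin n → 𝒴) => T p.1 p.2 :
          Finset (Fin M × (Fin n → 𝒴))) : Set _) =
      {ω | T ω.1 fun i : Fin n => runOut (fun k => e k ω.1) ω.2 i} := by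
    ext ω
    simp
  rw [h2] at h1
  rw [← h1, Finset.sum_filter, Fintype.sum_prod_type, Finset.mul_sum]
  refine Finset.sum_congr rfl fun w _ => ?_
  rw [Finset.mul_sum]
  refine Finset.sum_congr rfl fun y _ => ?_
  split_ifs
  swap
  · simp
  have hY : Nonempty 𝒴 := by
    by_contra h
    rw [not_nonempty_iff] at h
    have hX : IsEmpty 𝒳 := ⟨fun x => by simpa using (hP x).2⟩
    exact hX.false (e 0 w finZeroElim)
  let z : ℕ → 𝒴 := fun k => if h : k < n then y ⟨k, h⟩ else Classical.arbitrary 𝒴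
  have hz : ∀ i (hi : i < n), z i = y ⟨i, hi⟩ := fun i hi => by simp [z, hi]
  have h3 : (fun ω : Fin M × (ℕ × 𝒳 → 𝒴) =>
      (ω.1, fun i : Fin n => runOut (fun k => e k ω.1) ω.2 i)) ⁻¹' {(w, y)} =
      {ω | ω.1 = w ∧ ∀ i < n, runOut (fun k => e k ω.1) ω.2 i = z i} := by
    ext ω
    simp only [Set.mem_preimage, Set.mem_singleton_iff, Prod.mk.injEq, Set.mem_ofPred_eq]
    refine and_congr_right fun _ => ⟨fun h i hi => ?_, fun h => funext fun i => ?_⟩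
    · rw [hz i hi, ← h]
    · rw [h i i.2, hz i i.2]
  rw [h3, jointLaw_real hP, Finset.prod_range]
  congr 1
  refine Finset.prod_congr rfl fun i _ => ?_
  rw [hz i i.2]
  congr 2
  funext j
  exact hz j _

end Scheme

/-! ### Block codes and the confirm-and-retransmit scheme. -/

section Strategies

variable {𝒳 : Type u} {𝒴 : Type v}

/-- Sending a codeword, then a confirmation (by repeating one of two inputs) of what the receiver
has decoded, then a second codeword. -/
def twoPhaseEnc {M n₁ n₂ n₃ : ℕ} (x x' : 𝒳) (c₁ : Fin M → Fin n₁ → 𝒳)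
    (d₁ : (Fin n₁ → 𝒴) → Fin M) (c₂ : Fin M → Fin n₃ → 𝒳) (i : ℕ) (w : Fin M)
    (y : Fin i → 𝒴) : 𝒳 :=
  if h₁ : i < n₁ then c₁ w ⟨i, h₁⟩
  else if i < n₁ + n₂ then
    if d₁ (fun j => y ⟨j, j.2.trans_le (not_lt.1 h₁)⟩) = w then x else x'
  else if h₃ : i - (n₁ + n₂) < n₃ then c₂ w ⟨i - (n₁ + n₂), h₃⟩ else x

/-- Only the confirmation input depends on past outputs, and only through `d₁ a`, so the likelihood
splits into the three stages. -/
lemma prod_twoPhaseEnc (P : 𝒳 → 𝒴 → ℝ) {M n₁ n₂ n₃ : ℕ} (x x' : 𝒳) (c₁ : Fin M → Fin n₁ → 𝒳)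
    (d₁ : (Fin n₁ → 𝒴) → Fin M) (c₂ : Fin M → Fin n₃ → 𝒳) (w : Fin M) (a : Fin n₁ → 𝒴)
    (b : Fin n₂ → 𝒴) (c : Fin n₃ → 𝒴) :
    ∏ i : Fin (n₁ + n₂ + n₃), P (twoPhaseEnc (n₂ := n₂) x x' c₁ d₁ c₂ i w fun j : Fin i =>
        Fin.append (Fin.append a b) c ⟨j, j.2.trans i.2⟩) (Fin.append (Fin.append a b) c i) =
      (∏ i, P (c₁ w i) (a i)) * (∏ j, P (if d₁ a = w then x else x') (b j)) *
        ∏ k, P (c₂ w k) (c k) := by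
  rw [Fin.prod_univ_add, Fin.prod_univ_add]
  congr 1
  · congr 1
    · refine Finset.prod_congr rfl fun i _ => ?_
      simp [twoPhaseEnc]
    · refine Finset.prod_congr rfl fun j _ => ?_
      have h : (fun i : Fin n₁ => Fin.append (Fin.append a b) c
          ⟨i, (i.2.trans_le (by omega))⟩) = a := by
        funext i
        exact (Fin.append_left (Fin.append a b) c (Fin.castAdd n₂ i)).trans (Fin.append_left a b i)
      simp [twoPhaseEnc, h]
  · refine Finset.prod_congr rfl fun k _ => ?_
    have h : ¬ n₁ + n₂ + (k : ℕ) < n₁ := by omega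
    simp [twoPhaseEnc, h]

variable [Fintype 𝒴]

/-- Error probability of the block code with codewords `c` and decoder `d`. -/
noncomputable def blockError (P : 𝒳 → 𝒴 → ℝ) {M n : ℕ} (c : Fin M → Fin n → 𝒳)
    (d : (Fin n → 𝒴) → Fin M) : ℝ :=
  1 / (M : ℝ) * ∑ w, ∑ y, if d y ≠ w then ∏ i, P (c w i) (y i) else 0

lemma sum_sum_sum_mul {α β γ : Type*} [Fintype α] [Fintype β] [Fintype γ] (f : α → ℝ)
    (g : α → β → ℝ) (h : γ → ℝ) :
    ∑ a, ∑ b, ∑ c, f a * g a b * h c = (∑ a, f a * ∑ b, g a b) * ∑ c, h c := by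
  simp_rw [← Finset.mul_sum, ← Finset.sum_mul, ← Finset.mul_sum]

lemma sum_word_eq_one {P : 𝒳 → 𝒴 → ℝ} (hP : ∀ x, P x ∈ stdSimplex ℝ 𝒴) {n : ℕ}
    (c : Fin n → 𝒳) : ∑ y : Fin n → 𝒴, ∏ i, P (c i) (y i) = 1 := by
  rw [sum_pi_prod n fun i b => P (c i) b]
  simp [(hP _).2]

lemma sum_append {n m : ℕ} (f : (Fin (n + m) → 𝒴) → ℝ) :
    ∑ y, f y = ∑ a, ∑ b, f (Fin.append a b) := by
  rw [← (Fin.appendEquiv n m).sum_comp, Fintype.sum_prod_type]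
  rfl

lemma prod_word_nonneg {P : 𝒳 → 𝒴 → ℝ} (hP : ∀ x, P x ∈ stdSimplex ℝ 𝒴) {n : ℕ}
    (c : Fin n → 𝒳) (y : Fin n → 𝒴) : 0 ≤ ∏ i, P (c i) (y i) :=
  Finset.prod_nonneg fun _ _ => (hP _).1 _

/-- A rejection comes either with a wrong first decision, where the test is ignored, or with a right
one, where it is a false alarm under `x`. All remaining stages sum to one. -/
lemma sum_not_confirmed_le {P : 𝒳 → 𝒴 → ℝ} (hP : ∀ x, P x ∈ stdSimplex ℝ 𝒴) (x x' : 𝒳)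
    {M n₁ n₂ n₃ : ℕ} [NeZero M] (c₁ : Fin M → Fin n₁ → 𝒳) (d₁ : (Fin n₁ → 𝒴) → Fin M)
    (B : (Fin n₂ → 𝒴) → Prop) [DecidablePred B] (c₂ : Fin M → Fin n₃ → 𝒳) :
    (1 / (M : ℝ) * ∑ w, ∑ a : Fin n₁ → 𝒴, ∑ b, ∑ c : Fin n₃ → 𝒴, if ¬ B b then
        (∏ i, P (c₁ w i) (a i)) * (∏ j, P (if d₁ a = w then x else x') (b j)) *
        (∏ k, P (c₂ w k) (c k)) else 0) ≤
      blockError P c₁ d₁ + ∑ b, (if B b then 0 else ∏ j, P x (b j)) := by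
  have hM : (0 : ℝ) < M := Nat.cast_pos.2 (NeZero.pos M)
  calc _ ≤ 1 / (M : ℝ) * ∑ w : Fin M,
        (∑ a : Fin n₁ → 𝒴, ∑ b : Fin n₂ → 𝒴, ∑ c : Fin n₃ → 𝒴,
          ((if d₁ a ≠ w then ∏ i, P (c₁ w i) (a i) else 0) *
            (∏ j, P x' (b j)) * ∏ k, P (c₂ w k) (c k)) +
          ∑ a : Fin n₁ → 𝒴, ∑ b : Fin n₂ → 𝒴, ∑ c : Fin n₃ → 𝒴,
          ((∏ i, P (c₁ w i) (a i)) *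
            (if B b then 0 else ∏ j, P x (b j)) * ∏ k, P (c₂ w k) (c k))) := by
        refine mul_le_mul_of_nonneg_left (Finset.sum_le_sum fun w _ => ?_) (by positivity)
        simp_rw [← Finset.sum_add_distrib]
        refine Finset.sum_le_sum fun a _ => Finset.sum_le_sum fun b _ =>
          Finset.sum_le_sum fun c _ => ?_
        have h₁ := prod_word_nonneg hP (c₁ w) a
        have h₂ := prod_word_nonneg hP (fun _ => x) b
        have h₂' := prod_word_nonneg hP (fun _ => x') b
        have h₃ := prod_word_nonneg hP (c₂ w) c
        have h := mul_nonneg (mul_nonneg h₁ h₂) h₃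
        have h' := mul_nonneg (mul_nonneg h₁ h₂') h₃
        by_cases hb : B b <;> by_cases ha : d₁ a = w <;>
          simp only [hb, ha, ne_eq, not_true_eq_false, not_false_eq_true, if_true, if_false] <;>
          linarith
    _ = 1 / (M : ℝ) * ∑ w : Fin M, ((∑ a, if d₁ a ≠ w then ∏ i, P (c₁ w i) (a i) else 0) +
          ∑ b, (if B b then 0 else ∏ j, P x (b j))) := by
        congr 1
        refine Finset.sum_congr rfl fun w _ => ?_
        rw [sum_sum_sum_mul (fun a => if d₁ a ≠ w then ∏ i, P (c₁ w i) (a i) else 0)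
          (fun _ (b : Fin n₂ → 𝒴) => ∏ j, P x' (b j)) (fun c : Fin n₃ → 𝒴 => ∏ k, P (c₂ w k) (c k)),
          sum_sum_sum_mul (fun a : Fin n₁ → 𝒴 => ∏ i, P (c₁ w i) (a i))
          (fun _ b => if B b then 0 else ∏ j, P x (b j)) (fun c : Fin n₃ → 𝒴 => ∏ k, P (c₂ w k) (c k)),
          ← Finset.sum_mul, ← Finset.sum_mul, sum_word_eq_one hP (fun _ => x'),
          sum_word_eq_one hP, sum_word_eq_one hP]
        ring
    _ = _ := by
        rw [Finset.sum_add_distrib, mul_add, blockError]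
        congr 1
        simp [hM.ne']

/-- After acceptance, an error needs a wrong first decision and acceptance under `x'`; given that
decision the confirmation is fresh noise, so the probabilities multiply. After rejection only the
second decoder matters, and the earlier stages sum to one. -/
lemma sum_error_le {P : 𝒳 → 𝒴 → ℝ} (hP : ∀ x, P x ∈ stdSimplex ℝ 𝒴) (x x' : 𝒳)
    {M n₁ n₂ n₃ : ℕ} [NeZero M] (c₁ : Fin M → Fin n₁ → 𝒳) (d₁ : (Fin n₁ → 𝒴) → Fin M)
    (B : (Fin n₂ → 𝒴) → Prop) [DecidablePred B] (c₂ : Fin M → Fin n₃ → 𝒳)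
    (d₂ : (Fin n₃ → 𝒴) → Fin M) :
    (1 / (M : ℝ) * ∑ w, ∑ a, ∑ b, ∑ c,
        if (if B b then d₁ a ≠ w else d₂ c ≠ w) then
        (∏ i, P (c₁ w i) (a i)) * (∏ j, P (if d₁ a = w then x else x') (b j)) *
        (∏ k, P (c₂ w k) (c k)) else 0) ≤
      blockError P c₁ d₁ * ∑ b, (if B b then ∏ j, P x' (b j) else 0) + blockError P c₂ d₂ := by
  calc _ ≤ 1 / (M : ℝ) * ∑ w : Fin M,
        (∑ a : Fin n₁ → 𝒴, ∑ b : Fin n₂ → 𝒴, ∑ c : Fin n₃ → 𝒴,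
          ((if d₁ a ≠ w then ∏ i, P (c₁ w i) (a i) else 0) *
            (if B b then ∏ j, P x' (b j) else 0) * ∏ k, P (c₂ w k) (c k)) +
          ∑ a : Fin n₁ → 𝒴, ∑ b : Fin n₂ → 𝒴, ∑ c : Fin n₃ → 𝒴,
          ((∏ i, P (c₁ w i) (a i)) *
            (∏ j, P (if d₁ a = w then x else x') (b j)) *
              (if d₂ c ≠ w then ∏ k, P (c₂ w k) (c k) else 0))) := by
        refine mul_le_mul_of_nonneg_left (Finset.sum_le_sum fun w _ => ?_) (by positivity)
        simp_rw [← Finset.sum_add_distrib]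
        refine Finset.sum_le_sum fun a _ => Finset.sum_le_sum fun b _ =>
          Finset.sum_le_sum fun c _ => ?_
        have h₁ := prod_word_nonneg hP (c₁ w) a
        have h₂ := prod_word_nonneg hP (fun _ => x) b
        have h₂' := prod_word_nonneg hP (fun _ => x') b
        have h₃ := prod_word_nonneg hP (c₂ w) c
        have h := mul_nonneg (mul_nonneg h₁ h₂) h₃
        have h' := mul_nonneg (mul_nonneg h₁ h₂') h₃
        by_cases hb : B b <;> by_cases ha : d₁ a = w <;> by_cases hc : d₂ c = w <;>
          simp only [hb, ha, hc, ne_eq, not_true_eq_false, not_false_eq_true, if_true, if_false] <;>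
          linarith
    _ = 1 / (M : ℝ) * ∑ w : Fin M, ((∑ a, if d₁ a ≠ w then ∏ i, P (c₁ w i) (a i) else 0) *
          (∑ b, (if B b then ∏ j, P x' (b j) else 0)) +
          ∑ c, if d₂ c ≠ w then ∏ k, P (c₂ w k) (c k) else 0) := by
        congr 1
        refine Finset.sum_congr rfl fun w _ => ?_
        rw [sum_sum_sum_mul (fun a => if d₁ a ≠ w then ∏ i, P (c₁ w i) (a i) else 0)
          (fun _ b => if B b then ∏ j, P x' (b j) else 0) (fun c : Fin n₃ → 𝒴 => ∏ k, P (c₂ w k) (c k)),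
          sum_sum_sum_mul (fun a : Fin n₁ → 𝒴 => ∏ i, P (c₁ w i) (a i))
          (fun a (b : Fin n₂ → 𝒴) => ∏ j, P (if d₁ a = w then x else x') (b j))
          (fun c => if d₂ c ≠ w then ∏ k, P (c₂ w k) (c k) else 0),
          ← Finset.sum_mul, sum_word_eq_one hP]
        simp_rw [sum_word_eq_one hP fun _ => if d₁ _ = w then x else x', mul_one]
        rw [sum_word_eq_one hP, one_mul]
    _ = _ := by
        rw [Finset.sum_add_distrib, mul_add, ← Finset.sum_mul, ← mul_assoc, blockError,
          blockError]

variable [Fintype 𝒳] [MeasurableSpace 𝒳] [DiscreteMeasurableSpace 𝒳] [MeasurableSpace 𝒴]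
  [DiscreteMeasurableSpace 𝒴] {P : 𝒳 → 𝒴 → ℝ}

/-- A block code is a feedback scheme. -/
lemma exists_scheme_blockCode [Nonempty 𝒳] (hP : ∀ x, P x ∈ stdSimplex ℝ 𝒴) {M n : ℕ} [NeZero M]
    (c : Fin M → Fin n → 𝒳) (d : (Fin n → 𝒴) → Fin M) :
    ∃ S : FeedbackScheme P M,
      S.μ.real {ω | S.dec n (S.U ω) (fun i : Fin n => S.out i ω) ≠ S.msg ω} =
        blockError P c d := by
  let e : (k : ℕ) → Fin M → (Fin k → 𝒴) → 𝒳 := fun k w _ =>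
    if h : k < n then c w ⟨k, h⟩ else Classical.arbitrary 𝒳
  let dc : (k : ℕ) → (Fin k → 𝒴) → Fin M := fun k y =>
    if h : n ≤ k then d fun i => y (Fin.castLE h i) else 0
  refine ⟨detScheme hP e dc, ?_⟩
  have h := jointLaw_real_event hP e n fun w y => d y ≠ w
  have hd : ∀ y, dc n y = d y := fun y => by simp [dc]
  have he : ∀ (i : Fin n) w (y : Fin i → 𝒴), e i w y = c w i := fun i w y => by simp [e]
  simp only [he] at h
  rw [blockError, ← h]
  simp only [← hd]
  rfl

/-- A code with confirmation and retransmission. -/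
lemma exists_scheme_twoPhase (hP : ∀ x, P x ∈ stdSimplex ℝ 𝒴) (x x' : 𝒳) {M n₁ n₂ n₃ : ℕ}
    [NeZero M] (hn₃ : 0 < n₃) (c₁ : Fin M → Fin n₁ → 𝒳) (d₁ : (Fin n₁ → 𝒴) → Fin M)
    (B : (Fin n₂ → 𝒴) → Prop) [DecidablePred B] (c₂ : Fin M → Fin n₃ → 𝒳)
    (d₂ : (Fin n₃ → 𝒴) → Fin M) :
    ∃ (S : FeedbackScheme P M) (τ : S.Ω → ℕ),
      IsStoppingTime S.filtration (fun ω => (τ ω : WithTop ℕ)) ∧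
      (∀ ω, n₁ + n₂ ≤ τ ω ∧ τ ω ≤ n₁ + n₂ + n₃) ∧
      S.μ.real {ω | n₁ + n₂ < τ ω} ≤
        blockError P c₁ d₁ + ∑ b, (if B b then 0 else ∏ j, P x (b j)) ∧
      S.μ.real {ω | S.dec (τ ω) (S.U ω) (fun i : Fin (τ ω) => S.out i ω) ≠ S.msg ω} ≤
        blockError P c₁ d₁ * ∑ b, (if B b then ∏ j, P x' (b j) else 0) + blockError P c₂ d₂ := by
  let e : (k : ℕ) → Fin M → (Fin k → 𝒴) → 𝒳 := twoPhaseEnc (n₂ := n₂) x x' c₁ d₁ c₂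
  -- The decoder tells the two outcomes of the test apart by the stopping time alone, which is
  -- possible because `0 < n₃`. The default `0` is never used at a stopping time.
  let dc : (k : ℕ) → (Fin k → 𝒴) → Fin M := fun k y =>
    if h : n₁ + n₂ + n₃ ≤ k then d₂ fun i => y (Fin.castLE h (Fin.natAdd (n₁ + n₂) i))
    else if h : n₁ + n₂ ≤ k then d₁ fun i => y (Fin.castLE h (Fin.castAdd n₂ i)) else 0
  let S := detScheme hP e dc
  let blk : S.Ω → Fin n₂ → 𝒴 := fun ω j => S.out (n₁ + j) ω
  let τ : S.Ω → ℕ := fun ω => if B (blk ω) then n₁ + n₂ else n₁ + n₂ + n₃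
  have hB : ∀ k, n₁ + n₂ ≤ k → MeasurableSet[S.filtration k] {ω | B (blk ω)} := fun k hk =>
    measurableSet_filtration S hk fun y => B fun j => y (Fin.natAdd n₁ j)
  have hevent : ∀ (T : Fin M → (Fin n₁ → 𝒴) → (Fin n₂ → 𝒴) → (Fin n₃ → 𝒴) → Prop)
      [∀ w a b c, Decidable (T w a b c)],
      S.μ.real {ω | T (S.msg ω) (fun i => S.out i ω) (blk ω)
        (fun k => S.out (n₁ + n₂ + k) ω)} =
      1 / (M : ℝ) * ∑ w, ∑ a, ∑ b, ∑ c, if T w a b c then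
        (∏ i, P (c₁ w i) (a i)) * (∏ j, P (if d₁ a = w then x else x') (b j)) *
        (∏ k, P (c₂ w k) (c k)) else 0 := by
    intro T _
    refine (jointLaw_real_event hP e (n₁ + n₂ + n₃) fun w y => T w
      (fun i => y (Fin.castAdd n₃ (Fin.castAdd n₂ i)))
      (fun i => y (Fin.castAdd n₃ (Fin.natAdd n₁ i)))
      (fun i => y (Fin.natAdd (n₁ + n₂) i))).trans ?_
    congr 1
    refine Finset.sum_congr rfl fun w _ => ?_
    rw [sum_append, sum_append]
    refine Finset.sum_congr rfl fun a _ => Finset.sum_congr rfl fun b _ =>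
      Finset.sum_congr rfl fun c _ => ?_
    simp only [Fin.append_left, Fin.append_right, e]
    rw [prod_twoPhaseEnc]
  refine ⟨S, τ, fun k => ?_, fun ω => ?_, ?_, ?_⟩
  · have hle : {ω | (τ ω : WithTop ℕ) ≤ k} = {ω | τ ω ≤ k} := by
      ext ω
      exact WithTop.coe_le_coe
    change MeasurableSet[S.filtration k] {ω | (τ ω : WithTop ℕ) ≤ k}
    rw [hle]
    rcases lt_or_ge k (n₁ + n₂) with h | h
    · convert MeasurableSet.empty
      ext ω
      simp only [Set.mem_ofPred_eq, Set.mem_empty_iff_false, iff_false, not_le, τ]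
      split_ifs <;> omega
    · rcases lt_or_ge k (n₁ + n₂ + n₃) with h' | h'
      · convert hB k h using 1
        ext ω
        simp only [Set.mem_ofPred_eq, τ]
        split_ifs with hb <;> simp only [hb, iff_true, iff_false] <;> omega
      · convert MeasurableSet.univ
        ext ω
        simp only [Set.mem_ofPred_eq, Set.mem_univ, iff_true, τ]
        split_ifs <;> omega
  · simp only [τ]
    split_ifs <;> omega
  · have h1 : {ω | n₁ + n₂ < τ ω} = {ω | ¬ B (blk ω)} := by
      ext ω
      simp only [Set.mem_ofPred_eq, τ]
      split_ifs with hb <;> simp [hb, hn₃]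
    rw [h1, hevent fun _ _ b _ => ¬ B b]
    exact sum_not_confirmed_le hP x x' c₁ d₁ B c₂
  · have h1 : {ω | S.dec (τ ω) (S.U ω) (fun i : Fin (τ ω) => S.out i ω) ≠ S.msg ω} =
        {ω | if B (blk ω) then d₁ (fun i => S.out i ω) ≠ S.msg ω
          else d₂ (fun k => S.out (n₁ + n₂ + k) ω) ≠ S.msg ω} := by
      have hdec : ∀ ω, S.dec (τ ω) (S.U ω) (fun i : Fin (τ ω) => S.out i ω) =
          if B (blk ω) then d₁ (fun i => S.out i ω)
            else d₂ (fun k => S.out (n₁ + n₂ + k) ω) := by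
        intro ω
        change dc (τ ω) (fun i : Fin (τ ω) => S.out i ω) = _
        simp only [τ, dc]
        split_ifs <;> first | rfl | omega
      ext ω
      simp only [Set.mem_ofPred_eq]
      rw [hdec]
      split_ifs <;> rfl
    rw [h1, hevent fun w a b c => if B b then d₁ a ≠ w else d₂ c ≠ w]
    exact sum_error_le hP x x' c₁ d₁ B c₂ d₂

end Strategies

/-! ### Chernoff bounds for the confirmation test. -/

section Testing

variable {𝒴 : Type v} [Fintype 𝒴]

/-- Chernoff's bound for the missed detections of a likelihood ratio test. -/
lemma sum_accept_le {p q : 𝒴 → ℝ} (hp : ∀ y, 0 ≤ p y) (hq : ∀ y, 0 ≤ q y) {lam : ℝ}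
    (h1 : lam ≤ 1) {T : ℝ} (hT : 0 < T) (n : ℕ)
    [DecidablePred fun b : Fin n → 𝒴 => T * ∏ j, q (b j) ≤ ∏ j, p (b j)] :
    ∑ b : Fin n → 𝒴, (if T * ∏ j, q (b j) ≤ ∏ j, p (b j) then ∏ j, q (b j) else 0) ≤
      T ^ (-(1 - lam)) * (∑ y, p y ^ (1 - lam) * q y ^ lam) ^ n := by
  have hsum : (∑ y, p y ^ (1 - lam) * q y ^ lam) ^ n =
      ∑ b : Fin n → 𝒴, (∏ j, p (b j)) ^ (1 - lam) * (∏ j, q (b j)) ^ lam := by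
    rw [← Fin.prod_const n, ← sum_pi_prod n fun _ y => p y ^ (1 - lam) * q y ^ lam]
    refine Finset.sum_congr rfl fun b _ => ?_
    rw [Finset.prod_mul_distrib, Real.finsetProd_rpow _ _ fun j _ => hp _,
      Real.finsetProd_rpow _ _ fun j _ => hq _]
  rw [hsum, Finset.mul_sum]
  refine Finset.sum_le_sum fun b _ => ?_
  have hpb : 0 ≤ ∏ j, p (b j) := Finset.prod_nonneg fun j _ => hp _
  have hqb : 0 ≤ ∏ j, q (b j) := Finset.prod_nonneg fun j _ => hq _
  split_ifs with h
  · calc ∏ j, q (b j)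
        = (∏ j, q (b j)) ^ (1 - lam) * (∏ j, q (b j)) ^ lam := by
          rw [← Real.rpow_add' hqb (by simp), sub_add_cancel, Real.rpow_one]
      _ = T ^ (-(1 - lam)) * ((T * ∏ j, q (b j)) ^ (1 - lam) * (∏ j, q (b j)) ^ lam) := by
          rw [Real.mul_rpow hT.le hqb, Real.rpow_neg hT.le]
          have := (Real.rpow_pos_of_pos hT (1 - lam)).ne'
          field_simp
      _ ≤ _ := by
          have := sub_nonneg.2 h1
          gcongr
  · positivity

/-- Chernoff's bound for the false alarms of a likelihood ratio test. -/
lemma sum_reject_le {p q : 𝒴 → ℝ} (hp : ∀ y, 0 ≤ p y) (hq : ∀ y, 0 ≤ q y) {lam : ℝ}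
    (h0 : 0 ≤ lam) {T : ℝ} (hT : 0 < T) (n : ℕ)
    [DecidablePred fun b : Fin n → 𝒴 => T * ∏ j, q (b j) ≤ ∏ j, p (b j)] :
    ∑ b : Fin n → 𝒴, (if T * ∏ j, q (b j) ≤ ∏ j, p (b j) then 0 else ∏ j, p (b j)) ≤
      T ^ lam * (∑ y, p y ^ (1 - lam) * q y ^ lam) ^ n := by
  have hsum : (∑ y, p y ^ (1 - lam) * q y ^ lam) ^ n =
      ∑ b : Fin n → 𝒴, (∏ j, p (b j)) ^ (1 - lam) * (∏ j, q (b j)) ^ lam := by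
    rw [← Fin.prod_const n, ← sum_pi_prod n fun _ y => p y ^ (1 - lam) * q y ^ lam]
    refine Finset.sum_congr rfl fun b _ => ?_
    rw [Finset.prod_mul_distrib, Real.finsetProd_rpow _ _ fun j _ => hp _,
      Real.finsetProd_rpow _ _ fun j _ => hq _]
  rw [hsum, Finset.mul_sum]
  refine Finset.sum_le_sum fun b _ => ?_
  have hpb : 0 ≤ ∏ j, p (b j) := Finset.prod_nonneg fun j _ => hp _
  have hqb : 0 ≤ ∏ j, q (b j) := Finset.prod_nonneg fun j _ => hq _
  split_ifs with h
  · positivity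
  · rw [not_le] at h
    calc ∏ j, p (b j)
        = (∏ j, p (b j)) ^ (1 - lam) * (∏ j, p (b j)) ^ lam := by
          rw [← Real.rpow_add' hpb (by simp), sub_add_cancel, Real.rpow_one]
      _ ≤ (∏ j, p (b j)) ^ (1 - lam) * (T * ∏ j, q (b j)) ^ lam := by gcongr
      _ = _ := by
          rw [Real.mul_rpow hT.le hqb]
          ring

end Testing

/-! ### Divergences of the tilted distribution. -/

section Tilting

variable {𝒳 : Type u} {𝒴 : Type v} [Fintype 𝒴] {P : 𝒳 → 𝒴 → ℝ}

lemma kl_self (p : 𝒴 → ℝ) : kl p p = 0 := by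
  rw [kl, if_pos fun y h => h]
  norm_cast
  refine Finset.sum_eq_zero fun y _ => ?_
  rcases eq_or_ne (p y) 0 with h | h <;> simp [h]

lemma tilted_zero (hP : ∀ x, P x ∈ stdSimplex ℝ 𝒴) (x x' : 𝒳) : tilted P x x' 0 = P x := by
  funext y
  simp [tilted, (hP x).2]

lemma tilted_one (hP : ∀ x, P x ∈ stdSimplex ℝ 𝒴) (x x' : 𝒳) : tilted P x x' 1 = P x' := by
  funext y
  simp [tilted, (hP x').2]

/-- Parameters with vanishing denominator are not excluded in `Eee'`. Division by zero gives the
zero function there, whose divergence is `0`, so a positive `γ` rules them out. -/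
lemma kl_tilted_of_sum_eq_zero (x x' : 𝒳) {lam : ℝ}
    (hZ : ∑ a, P x a ^ (1 - lam) * P x' a ^ lam = 0) (q : 𝒴 → ℝ) :
    kl (tilted P x x' lam) q = 0 := by
  have h : tilted P x x' lam = fun _ => 0 := by
    funext y
    simp [tilted, hZ]
  rw [h, kl, if_pos fun _ _ => rfl]
  simp

/-- The divergences of the tilted distribution from the two distributions that it interpolates,
in terms of the mean `θ` of the log-likelihood ratio. -/
lemma exists_kl_tilted_eq (hP : ∀ x, P x ∈ stdSimplex ℝ 𝒴) (x x' : 𝒳) {lam : ℝ} (h0 : 0 < lam)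
    (h1 : lam < 1) (hZ : ∑ a, P x a ^ (1 - lam) * P x' a ^ lam ≠ 0) :
    ∃ θ : ℝ,
      kl (tilted P x x' lam) (P x) =
        ((-lam * θ - Real.logb 2 (∑ a, P x a ^ (1 - lam) * P x' a ^ lam) : ℝ) : EReal) ∧
      kl (tilted P x x' lam) (P x') =
        (((1 - lam) * θ - Real.logb 2 (∑ a, P x a ^ (1 - lam) * P x' a ^ lam) : ℝ) : EReal) := by
  set Z := ∑ a, P x a ^ (1 - lam) * P x' a ^ lam with hZdef
  have hsum : ∑ y, tilted P x x' lam y = 1 := by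
    simp only [tilted]
    rw [← Finset.sum_div, ← hZdef, div_self hZ]
  have hlZ : Real.logb 2 Z = ∑ y, tilted P x x' lam y * Real.logb 2 Z := by
    rw [← Finset.sum_mul, hsum, one_mul]
  have hx : ∀ y, P x y = 0 → tilted P x x' lam y = 0 := fun y h => by
    rw [tilted, h, Real.zero_rpow (sub_pos.2 h1).ne', zero_mul, zero_div]
  have hx' : ∀ y, P x' y = 0 → tilted P x x' lam y = 0 := fun y h => by
    rw [tilted, h, Real.zero_rpow h0.ne', mul_zero, zero_div]
  have hlog : ∀ y, P x y ≠ 0 → P x' y ≠ 0 → Real.logb 2 (tilted P x x' lam y) =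
      (1 - lam) * Real.logb 2 (P x y) + lam * Real.logb 2 (P x' y) - Real.logb 2 Z := by
    intro y hy hy'
    have hp := lt_of_le_of_ne ((hP x).1 y) hy.symm
    have hp' := lt_of_le_of_ne ((hP x').1 y) hy'.symm
    have e1 := (Real.rpow_pos_of_pos hp (1 - lam)).ne'
    have e2 := (Real.rpow_pos_of_pos hp' lam).ne'
    rw [tilted, Real.logb_div (mul_ne_zero e1 e2) hZ, Real.logb_mul e1 e2,
      Real.logb_rpow_eq_mul_logb_of_pos hp, Real.logb_rpow_eq_mul_logb_of_pos hp']
  refine ⟨∑ y, tilted P x x' lam y * Real.logb 2 (P x y / P x' y), ?_, ?_⟩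
  · rw [kl, if_pos hx]
    congr 1
    rw [hlZ, Finset.mul_sum, ← Finset.sum_sub_distrib]
    refine Finset.sum_congr rfl fun y _ => ?_
    rcases eq_or_ne (tilted P x x' lam y) 0 with ht | ht
    · simp [ht]
    · have hy := fun h => ht (hx y h)
      have hy' := fun h => ht (hx' y h)
      rw [Real.logb_div ht hy, Real.logb_div hy hy', hlog y hy hy']
      ring
  · rw [kl, if_pos hx']
    congr 1
    rw [hlZ, Finset.mul_sum, ← Finset.sum_sub_distrib]
    refine Finset.sum_congr rfl fun y _ => ?_
    rcases eq_or_ne (tilted P x x' lam y) 0 with ht | ht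
    · simp [ht]
    · have hy := fun h => ht (hx y h)
      have hy' := fun h => ht (hx' y h)
      rw [Real.logb_div ht hy', Real.logb_div hy hy', hlog y hy hy']
      ring

end Tilting

/-! ### Achievable exponents of the two strategies. -/

section Asymptotics

/-- Absorbs the constants from union bounds and from rounding block lengths into a gap between
exponents. -/
lemma eventually_mul_two_rpow_le (C : ℝ) {E₁ E₂ : ℝ} (h : E₂ < E₁) :
    ∀ᶠ ℓ : ℕ in Filter.atTop, C * (2 : ℝ) ^ (-(ℓ * E₁)) ≤ (2 : ℝ) ^ (-(ℓ * E₂)) := by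
  have ht : Filter.Tendsto (fun ℓ : ℕ => (2 : ℝ) ^ ((ℓ : ℝ) * (E₁ - E₂))) Filter.atTop
      Filter.atTop :=
    (tendsto_rpow_atTop_of_base_gt_one 2 one_lt_two).comp
      (tendsto_natCast_atTop_atTop.atTop_mul_const (sub_pos.2 h))
  filter_upwards [ht.eventually_ge_atTop C] with ℓ hℓ
  calc C * (2 : ℝ) ^ (-(ℓ * E₁))
      ≤ (2 : ℝ) ^ ((ℓ : ℝ) * (E₁ - E₂)) * (2 : ℝ) ^ (-(ℓ * E₁)) := by gcongr
    _ = _ := by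
      rw [← Real.rpow_add two_pos]
      ring_nf

lemma two_rpow_neg_mem_Ioo {ℓ : ℕ} (hℓ : 1 ≤ ℓ) {E : ℝ} (hE : 0 < E) :
    (2 : ℝ) ^ (-(ℓ * E)) ∈ Set.Ioo (0 : ℝ) 1 := by
  have h : (0 : ℝ) < ℓ := by exact_mod_cast hℓ
  exact ⟨by positivity, Real.rpow_lt_one_of_one_lt_of_neg one_lt_two (by
    rw [neg_lt_zero]
    positivity)⟩

/-- Gallager's bound counts the `m` competitors of a codeword, so with `m + 1` the ceiling of `2 ^
(ℓ R)` rounding costs nothing in the exponent. -/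
lemma exists_card_messages (ℓ : ℕ) (R : ℝ) :
    ∃ m : ℕ, (m : ℝ) ≤ (2 : ℝ) ^ (ℓ * R) ∧ (2 : ℝ) ^ (ℓ * R) ≤ ((m + 1 : ℕ) : ℝ) := by
  have hpos : (0 : ℝ) < (2 : ℝ) ^ (ℓ * R) := by positivity
  obtain ⟨m, hm⟩ := Nat.exists_eq_add_of_lt (Nat.ceil_pos.2 hpos)
  rw [zero_add] at hm
  refine ⟨m, ?_, hm ▸ Nat.le_ceil _⟩
  have h := Nat.ceil_lt_add_one hpos.le
  rw [hm] at h
  push_cast at h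
  linarith

lemma le_reliability_of_achievable {𝒳 : Type u} {𝒴 : Type v} [MeasurableSpace 𝒳]
    [MeasurableSpace 𝒴] {P : 𝒳 → 𝒴 → ℝ} {γ R E : ℝ} {K : ℕ} (h : Achievable P γ K R E) :
    (E : EReal) ≤ reliability P R γ K :=
  le_iSup₂ (f := fun (E : ℝ) (_ : E ∈ {E : ℝ | Achievable P γ K R E}) => (E : EReal)) E h

variable {𝒳 : Type u} {𝒴 : Type v} [Fintype 𝒳] [Fintype 𝒴] {P : 𝒳 → 𝒴 → ℝ}

/-- Block codes of length at least `β ℓ` attain the exponent `β E_r(R / β)` per `ℓ` when they have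
about `2 ^ (ℓ R)` messages. -/
lemma exists_blockError_le [Nonempty 𝒳] (hP : ∀ x, P x ∈ stdSimplex ℝ 𝒴) {R β E : ℝ} (hR : 0 ≤ R)
    (hβ : 0 < β) (hE₀ : 0 ≤ E) (hE : E < β * Er P (R / β)) {ℓ n m : ℕ} (hn : β * ℓ ≤ n)
    (hm : (m : ℝ) ≤ (2 : ℝ) ^ (ℓ * R)) :
    ∃ (c : Fin (m + 1) → Fin n → 𝒳) (d : (Fin n → 𝒴) → Fin (m + 1)),
      blockError P c d ≤ (2 : ℝ) ^ (-(ℓ * E)) := by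
  have hE' : E / β < Er P (R / β) := by
    rw [div_lt_iff₀ hβ]
    linarith
  obtain ⟨ρ, Q, h0, h1, hQ, hρ⟩ := exists_lt_of_lt_Er hE'
  obtain ⟨c, d, h⟩ := exists_blockCode_le P hP Q hQ n m h0 h1
  refine ⟨c, d, ?_⟩
  rw [gallagerSum_eq hP hQ h0 h1] at h
  -- Nonnegativity ensures that rounding the block length up to `n` can only help.
  have hE0 : 0 ≤ gallagerE0 P ρ Q := by
    have := div_nonneg hE₀ hβ.le
    have := mul_nonneg h0 (div_nonneg hR hβ.le)
    linarith
  have hβE : E + ρ * R < β * gallagerE0 P ρ Q := by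
    have h2 := mul_lt_mul_of_pos_left hρ hβ
    have h3 : β * (E / β) = E := by field_simp
    have h4 : β * (ρ * (R / β)) = ρ * R := by field_simp
    linarith
  have hmpos : (0 : ℝ) < (m : ℝ) + 1 := by positivity
  calc blockError P c d
      ≤ 1 / ((m : ℝ) + 1) * (((m : ℝ) + 1) *
          ((m : ℝ) ^ ρ * ((2 : ℝ) ^ (-gallagerE0 P ρ Q)) ^ n)) := by
        rw [blockError]
        push_cast
        gcongr
    _ = (m : ℝ) ^ ρ * ((2 : ℝ) ^ (-gallagerE0 P ρ Q)) ^ n := by field_simp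
    _ ≤ ((2 : ℝ) ^ (ℓ * R)) ^ ρ * ((2 : ℝ) ^ (-gallagerE0 P ρ Q)) ^ n := by gcongr
    _ = (2 : ℝ) ^ (ℓ * R * ρ + -gallagerE0 P ρ Q * n) := by
        rw [← Real.rpow_natCast, ← Real.rpow_mul two_pos.le, ← Real.rpow_mul two_pos.le,
          ← Real.rpow_add two_pos]
    _ ≤ _ := by
        refine Real.rpow_le_rpow_of_exponent_le one_le_two ?_
        have h5 := mul_le_mul_of_nonneg_left hn hE0
        have h6 := mul_le_mul_of_nonneg_left hβE.le (Nat.cast_nonneg (α := ℝ) ℓ)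
        linarith

variable [MeasurableSpace 𝒳] [DiscreteMeasurableSpace 𝒳] [MeasurableSpace 𝒴]
  [DiscreteMeasurableSpace 𝒴]

/-- Block codes attain the random coding exponent. -/
lemma achievable_Er [Nonempty 𝒳] (hP : ∀ x, P x ∈ stdSimplex ℝ 𝒴) {R : ℝ} (hR₀ : 0 ≤ R)
    (hRC : R < capacity P) (γ : ℝ) {K : ℕ} (hK : 1 ≤ K) : Achievable P γ K R (Er P R) := by
  intro δ hδ
  have hpos := Er_pos hP hRC
  obtain ⟨E, hE, hE'⟩ : ∃ E, max 0 (Er P R - δ) < E ∧ E < Er P R :=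
    -- Positivity of `E` makes the error bound smaller than one, as a code requires.
    exists_between (max_lt hpos (by linarith))
  obtain ⟨hE0, hEδ⟩ := max_lt_iff.1 hE
  refine ⟨1, fun ℓ hℓ => ?_⟩
  obtain ⟨m, hm, hm'⟩ := exists_card_messages ℓ R
  obtain ⟨c, d, hcd⟩ := exists_blockError_le hP hR₀ one_pos hE0.le (by simpa using hE')
    (ℓ := ℓ) (n := ℓ) (by simp) hm
  obtain ⟨S, hS⟩ := exists_scheme_blockCode hP c d
  refine ⟨m + 1, (2 : ℝ) ^ (-(ℓ * E)), S, fun _ => ℓ, ⟨two_rpow_neg_mem_Ioo hℓ hE0,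
    isStoppingTime_const _ _, fun _ => hℓ, ?_, .of_forall fun _ => ?_, hS.trans_le hcd⟩, hm', ?_⟩
  · simp only [lt_irrefl]
    simp
    positivity
  · exact Nat.le_mul_of_pos_left ℓ hK
  · refine Real.rpow_le_rpow_of_exponent_le one_le_two (neg_le_neg ?_)
    gcongr

/-- The exponents that confirmation and retransmission attain. Here `α` is the fraction of the
first `ℓ` channel uses that is spent on the message, `A` the exponent of that part, and `θ` the
threshold of the test of the confirmation. -/
lemma achievable_twoPhase (hP : ∀ x, P x ∈ stdSimplex ℝ 𝒴) (x x' : 𝒳) {R γ α lam θ Λ A E : ℝ}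
    {K : ℕ} (hR : 0 ≤ R) (hγ : 0 < γ) (hK : 2 ≤ K) (hα₀ : 0 < α) (hα₁ : α < 1) (h0 : 0 ≤ lam)
    (h1 : lam ≤ 1) (hΛ : ∑ a, P x a ^ (1 - lam) * P x' a ^ lam = (2 : ℝ) ^ Λ)
    (hA : A < α * Er P (R / α)) (hγA : γ < A) (hfa : γ < (1 - α) * (-lam * θ - Λ))
    (hE₀ : 0 < E) (hE : E < A + (1 - α) * ((1 - lam) * θ - Λ))
    (hEK : E < ((K : ℝ) - 1) * Er P (R / ((K : ℝ) - 1))) :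
    Achievable P γ K R E := by
  classical
  have : Nonempty 𝒳 := ⟨x⟩
  intro δ hδ
  obtain ⟨E₃, hEE₃, hE₃⟩ := exists_between hEK
  have hK1 : (0 : ℝ) < (K : ℝ) - 1 := by
    have : (2 : ℝ) ≤ K := by exact_mod_cast hK
    linarith
  set f := -lam * θ - Λ with hf
  set e := (1 - lam) * θ - Λ with he
  have hf0 : 0 < f := by
    by_contra hcon
    have := mul_nonpos_of_nonneg_of_nonpos (sub_pos.2 hα₁).le (not_lt.1 hcon)
    linarith
  -- The factors `2` make each term of a two-term union bound at most half of its target; `2 ^ f`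
  -- and `2 ^ |e|` pay for rounding the length of the confirmation.
  have hev := ((eventually_mul_two_rpow_le 2 hγA).and
    (eventually_mul_two_rpow_le (2 * 2 ^ f) hfa)).and
    (((eventually_mul_two_rpow_le (2 * 2 ^ |e|) hE).and (eventually_mul_two_rpow_le 2 hEE₃)).and
    (Filter.eventually_ge_atTop 1))
  obtain ⟨ℓ₀, hℓ₀⟩ := Filter.eventually_atTop.1 hev
  refine ⟨ℓ₀, fun ℓ hℓ => ?_⟩
  obtain ⟨⟨b1, b2⟩, ⟨b3, b4⟩, hℓ1⟩ := hℓ₀ ℓ hℓ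
  obtain ⟨m, hm, hm'⟩ := exists_card_messages ℓ R
  have hαℓ : 0 ≤ α * ℓ := by positivity
  have hn₁ : ⌈α * ℓ⌉₊ ≤ ℓ := Nat.ceil_le.2 (mul_le_of_le_one_left (Nat.cast_nonneg ℓ) hα₁.le)
  obtain ⟨n₂, hn₂⟩ := Nat.exists_eq_add_of_le hn₁
  have hlo := Nat.le_ceil (α * ℓ)
  have hhi := Nat.ceil_lt_add_one hαℓ
  generalize hn : ⌈α * ℓ⌉₊ = n₁ at hn₁ hn₂ hlo hhi
  have hcast : (ℓ : ℝ) = n₁ + n₂ := by exact_mod_cast hn₂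
  obtain ⟨c₁, d₁, hcd₁⟩ := exists_blockError_le hP hR hα₀ (hγ.trans hγA).le hA hlo hm
  obtain ⟨c₂, d₂, hcd₂⟩ := exists_blockError_le hP hR hK1 (hE₀.trans hEE₃).le hE₃
    (ℓ := ℓ) (n := (K - 1) * ℓ) (by push_cast [Nat.cast_sub (show 1 ≤ K by omega)]; rfl) hm
  have hT : (0 : ℝ) < (2 : ℝ) ^ (n₂ * θ) := by positivity
  obtain ⟨S, τ, hτ, hτb, hex, herr⟩ := exists_scheme_twoPhase hP x x' (n₂ := n₂)
    (Nat.mul_pos (by omega : 0 < K - 1) hℓ1) c₁ d₁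
    (fun b => (2 : ℝ) ^ (n₂ * θ) * ∏ j, P x' (b j) ≤ ∏ j, P x (b j)) c₂ d₂
  have hacc := sum_accept_le (hP x).1 (hP x').1 h1 hT n₂
  have hrej := sum_reject_le (hP x).1 (hP x').1 h0 hT n₂
  have hacc' : ((2 : ℝ) ^ (n₂ * θ)) ^ (-(1 - lam)) * ((2 : ℝ) ^ Λ) ^ n₂ ≤
      2 ^ |e| * (2 : ℝ) ^ (-(ℓ * ((1 - α) * e))) := by
    rw [← Real.rpow_natCast, ← Real.rpow_mul two_pos.le, ← Real.rpow_mul two_pos.le,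
      ← Real.rpow_add two_pos, ← Real.rpow_add two_pos]
    refine Real.rpow_le_rpow_of_exponent_le one_le_two ?_
    -- The bracket equals `n₁ - α ℓ`, the rounding error of the ceiling, which lies in `[0, 1)`. The
    -- absolute value is needed since `e` may be negative.
    have h2 : (ℓ - α * ℓ - n₂) * e ≤ |e| := by
      refine (le_abs_self _).trans ?_
      rw [abs_mul]
      refine mul_le_of_le_one_left (abs_nonneg e) ?_
      rw [abs_le]
      constructor <;> linarith
    have h3 : (n₂ : ℝ) * θ * -(1 - lam) + Λ * n₂ = -(n₂ * e) := by
      rw [he]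
      ring
    rw [h3]
    linarith
  have hrej' : ((2 : ℝ) ^ (n₂ * θ)) ^ lam * ((2 : ℝ) ^ Λ) ^ n₂ ≤
      2 ^ f * (2 : ℝ) ^ (-(ℓ * ((1 - α) * f))) := by
    rw [← Real.rpow_natCast, ← Real.rpow_mul two_pos.le, ← Real.rpow_mul two_pos.le,
      ← Real.rpow_add two_pos, ← Real.rpow_add two_pos]
    refine Real.rpow_le_rpow_of_exponent_le one_le_two ?_
    have h2 : (ℓ - α * ℓ - n₂) * f ≤ 1 * f :=
      mul_le_mul_of_nonneg_right (by linarith) hf0.le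
    have h3 : (n₂ : ℝ) * θ * lam + Λ * n₂ = -(n₂ * f) := by
      rw [hf]
      ring
    rw [h3]
    linarith
  rw [hΛ] at hacc hrej
  have hlen : n₁ + n₂ + (K - 1) * ℓ = K * ℓ := by
    obtain ⟨k, rfl⟩ := Nat.exists_eq_add_of_le hK
    rw [← hn₂, show 2 + k - 1 = k + 1 by omega]
    ring
  rw [hlen, ← hn₂] at hτb
  rw [← hn₂] at hex
  refine ⟨m + 1, (2 : ℝ) ^ (-(ℓ * E)), S, τ, ⟨two_rpow_neg_mem_Ioo hℓ1 hE₀, hτ,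
    fun ω => hℓ1.trans (hτb ω).1, ?_, .of_forall fun ω => (hτb ω).2, ?_⟩, hm', ?_⟩
  · rw [mul_comm γ]
    linarith
  · refine herr.trans ?_
    have hsplit : (2 : ℝ) ^ (-(ℓ * A)) * (2 ^ |e| * (2 : ℝ) ^ (-(ℓ * ((1 - α) * e)))) =
        2 ^ |e| * (2 : ℝ) ^ (-(ℓ * (A + (1 - α) * e))) := by
      rw [mul_left_comm, ← Real.rpow_add two_pos]
      ring_nf
    have hprod := mul_le_mul hcd₁ (hacc.trans hacc')
      (Finset.sum_nonneg fun b _ => by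
        split_ifs
        · exact prod_word_nonneg hP (fun _ => x') b
        · exact le_rfl) (by positivity)
    rw [hsplit] at hprod
    linarith
  · refine Real.rpow_le_rpow_of_exponent_le one_le_two (neg_le_neg ?_)
    gcongr
    linarith

end Asymptotics

/-! ### From strict inequalities to the closed optimization region. -/

section Reliability

variable {𝒳 : Type u} {𝒴 : Type v} [Fintype 𝒳] [Fintype 𝒴] [MeasurableSpace 𝒳]
  [DiscreteMeasurableSpace 𝒳] [MeasurableSpace 𝒴] [DiscreteMeasurableSpace 𝒴] {P : 𝒳 → 𝒴 → ℝ}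

lemma le_reliability_of_lt (hP : ∀ x, P x ∈ stdSimplex ℝ 𝒴) (x x' : 𝒳) {R γ α lam D₁ D₂ θ E : ℝ}
    {K : ℕ} (hR : 0 < R) (hγ : 0 < γ) (hγE : γ < Er P R) (hRC : R < capacity P) (hK : 2 ≤ K)
    (hα : alphaStar P R γ ≤ α) (hα₁ : α < 1) (h0 : 0 < lam) (h1 : lam < 1)
    (hZ : 0 < ∑ a, P x a ^ (1 - lam) * P x' a ^ lam)
    (hD₁ : D₁ = -lam * θ - Real.logb 2 (∑ a, P x a ^ (1 - lam) * P x' a ^ lam))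
    (hD₂ : D₂ = (1 - lam) * θ - Real.logb 2 (∑ a, P x a ^ (1 - lam) * P x' a ^ lam))
    (hfa : γ ≤ (1 - α) * D₁) (hE : E < α * Er P (R / α) + (1 - α) * D₂)
    (hEK : E < ((K : ℝ) - 1) * Er P (R / ((K : ℝ) - 1))) :
    (E : EReal) ≤ reliability P R γ K := by
  have : Nonempty 𝒳 := ⟨x⟩
  have hrel := le_reliability_of_achievable
    (achievable_Er hP hR.le hRC γ (show 1 ≤ K by omega))
  -- Exponents up to `Er P R` are met by block codes; above it, `E` is positive, which the two-phase
  -- scheme needs.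
  rcases le_or_gt E (Er P R) with hle | hlt
  · exact (EReal.coe_le_coe_iff.2 hle).trans hrel
  obtain ⟨hs, hstar⟩ := alphaStar_spec hP hR hγ hγE
  have hα₀ : 0 < α := hs.trans_le hα
  set Λ := Real.logb 2 (∑ a, P x a ^ (1 - lam) * P x' a ^ lam) with hΛ
  -- Lowering the threshold from `θ` to `θ - η` raises the false-alarm exponent by `(1 - α) lam η >
  -- 0` and costs the error exponent at most `η`.
  obtain ⟨η, hη, hη'⟩ : ∃ η : ℝ, 0 < η ∧ η < α * Er P (R / α) + (1 - α) * D₂ - E :=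
    exists_between (sub_pos.2 hE)
  have hEη : E < α * Er P (R / α) + (1 - α) * ((1 - lam) * (θ - η) - Λ) := by
    have h2 : (1 - α) * (1 - lam) * η ≤ 1 * η :=
      mul_le_mul_of_nonneg_right (mul_le_one₀ (by linarith) (by linarith) (by linarith)) hη.le
    rw [hD₂] at hη'
    linarith
  have hfaη : γ < (1 - α) * (-lam * (θ - η) - Λ) := by
    have h2 : 0 < (1 - α) * (lam * η) := mul_pos (by linarith) (mul_pos h0 hη)
    rw [hD₁] at hfa
    linarith
  have hcE : ContinuousAt
      (fun α => α * Er P (R / α) + (1 - α) * ((1 - lam) * (θ - η) - Λ)) α := by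
    have hdiv : ContinuousAt (fun α : ℝ => R / α) α := continuousAt_const.div continuousAt_id hα₀.ne'
    have hEr : ContinuousAt (fun α : ℝ => Er P (R / α)) α :=
      ContinuousAt.comp (f := fun α : ℝ => R / α) (Er_continuous hP).continuousAt hdiv
    fun_prop
  have hcfa : ContinuousAt (fun α => (1 - α) * (-lam * (θ - η) - Λ)) α := by fun_prop
  -- A slightly larger `β` lies strictly above `α*`, so the first decoding error also has exponent
  -- above `γ`; by continuity both strict inequalities survive.
  obtain ⟨β, ⟨hβE, hβfa⟩, hαβ, hβ₁⟩ :=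
    (((hcE.eventually_const_lt hEη).and (hcfa.eventually_const_lt hfaη)).filter_mono
      nhdsWithin_le_nhds |>.and (Ioo_mem_nhdsGT hα₁)).exists
  obtain ⟨A, hA, hA'⟩ := exists_between
    (max_lt (hstar β (hα.trans_lt hαβ)) (sub_lt_iff_lt_add.2 hβE))
  obtain ⟨hγA, hEA⟩ := max_lt_iff.1 hA
  refine le_reliability_of_achievable (achievable_twoPhase hP x x' (θ := θ - η) (Λ := Λ) hR.le hγ
    hK (hα₀.trans hαβ) hβ₁ h0.le h1.le ?_ hA' hγA hβfa ((hγ.trans hγE).trans hlt)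
    (sub_lt_iff_lt_add.1 hEA) hEK)
  rw [hΛ, Real.rpow_logb two_pos (by norm_num) hZ]

lemma Eee''_le_reliability (hP : ∀ x, P x ∈ stdSimplex ℝ 𝒴) (x x' : 𝒳) {R γ α lam : ℝ} {K : ℕ}
    (hR : 0 < R) (hγ : 0 < γ) (hγE : γ < Er P R) (hRC : R < capacity P) (hK : 2 ≤ K)
    (hα : α ∈ Set.Icc (alphaStar P R γ) 1) (hlam : lam ∈ Set.Icc (0 : ℝ) 1)
    (hfa : (γ : EReal) ≤ ((1 - α : ℝ) : EReal) * kl (tilted P x x' lam) (P x))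
    (hEK : reliability P R γ K < (((((K : ℝ) - 1) * Er P (R / ((K : ℝ) - 1)) : ℝ)) : EReal)) :
    Eee'' P x x' α lam R ≤ reliability P R γ K := by
  have : Nonempty 𝒳 := ⟨x⟩
  have hrel := le_reliability_of_achievable
    (achievable_Er hP hR.le hRC γ (show 1 ≤ K by omega))
  have hα₀ : 0 < α := (alphaStar_spec hP hR hγ hγE).1.trans_le hα.1
  have hγ' : (0 : EReal) < γ := by exact_mod_cast hγ
  -- With `α = 1` or `lam = 0` the constraint would read `γ ≤ 0`.
  have hα₁ : α < 1 := by
    refine lt_of_le_of_ne hα.2 ?_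
    rintro rfl
    simp only [sub_self, EReal.coe_zero, zero_mul] at hfa
    exact absurd hγ' (not_lt.2 hfa)
  rcases hlam.1.eq_or_lt with rfl | h0
  · rw [tilted_zero hP, kl_self, mul_zero] at hfa
    exact absurd hγ' (not_lt.2 hfa)
  rcases hlam.2.eq_or_lt with rfl | h1
  -- At `lam = 1` the divergence gain vanishes, and `α Er (R / α) ≤ Er R` is attained by block
  -- codes.
  · rw [Eee'', tilted_one hP, kl_self, mul_zero, add_zero]
    refine le_trans (EReal.coe_le_coe_iff.2 ?_) hrel
    calc α * Er P (R / α) ≤ 1 * Er P (R / α) :=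
          mul_le_mul_of_nonneg_right hα.2 (Er_nonneg hP _)
      _ ≤ Er P R := by
          rw [one_mul]
          refine Er_antitone hP ?_
          rw [le_div_iff₀ hα₀]
          exact mul_le_of_le_one_right hR.le hα.2
  by_cases hZ : ∑ a, P x a ^ (1 - lam) * P x' a ^ lam = 0
  · rw [kl_tilted_of_sum_eq_zero x x' hZ, mul_zero] at hfa
    exact absurd hγ' (not_lt.2 hfa)
  obtain ⟨θ, hθ, hθ'⟩ := exists_kl_tilted_eq hP x x' h0 h1 hZ
  have hZ' : 0 < ∑ a, P x a ^ (1 - lam) * P x' a ^ lam :=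
    lt_of_le_of_ne (Finset.sum_nonneg fun a _ => mul_nonneg (Real.rpow_nonneg ((hP x).1 a) _)
      (Real.rpow_nonneg ((hP x').1 a) _)) (Ne.symm hZ)
  rw [hθ, ← EReal.coe_mul, EReal.coe_le_coe_iff] at hfa
  rw [Eee'', hθ', ← EReal.coe_mul, ← EReal.coe_add]
  -- Otherwise a real `E` lies above the reliability but below both terms of the minimum, and such
  -- an `E` is attained.
  by_contra hcon
  obtain ⟨E, hE, hE'⟩ := EReal.lt_iff_exists_real_btwn.1 (lt_min (not_le.1 hcon) hEK)
  obtain ⟨hE₁, hE₂⟩ := lt_min_iff.1 hE'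
  exact absurd hE (not_lt.2 (le_reliability_of_lt hP x x' hR hγ hγE hRC hK hα.1 hα₁ h0 h1 hZ' rfl
    rfl hfa (EReal.coe_lt_coe_iff.1 hE₁) (EReal.coe_lt_coe_iff.1 hE₂)))

end Reliability

end AFLF

theorem mainTheorem3 {𝒳 : Type u} {𝒴 : Type v} [Fintype 𝒳] [Fintype 𝒴]
    [MeasurableSpace 𝒳] [DiscreteMeasurableSpace 𝒳]
    [MeasurableSpace 𝒴] [DiscreteMeasurableSpace 𝒴]
    (P : 𝒳 → 𝒴 → ℝ) (hP : ∀ x, P x ∈ stdSimplex ℝ 𝒴)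
    (x x' : 𝒳) (hxx' : ∀ a b : 𝒳, AFLF.kl (P a) (P b) ≤ AFLF.kl (P x) (P x'))
    (R γ : ℝ) (hR₀ : 0 ≤ R) (hRC : R < AFLF.capacity P) (K : ℕ) (hK : 1 ≤ K) :
    (0 < R → 0 < γ → γ < AFLF.Er P R →
      (∃! a : ℝ, 0 < a ∧ AFLF.g P a = γ / R) ∧
      min (AFLF.Eee' P x x' R γ)
          (((((K : ℝ) - 1) * AFLF.Er P (R / ((K : ℝ) - 1)) : ℝ)) : EReal) ≤
        AFLF.reliability P R γ K) ∧
    (AFLF.Er P R < γ → (AFLF.Er P R : EReal) ≤ AFLF.reliability P R γ K) := by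
  have : Nonempty 𝒳 := ⟨x⟩
  have hrel := AFLF.le_reliability_of_achievable (AFLF.achievable_Er hP hR₀ hRC γ hK)
  refine ⟨fun hR hγ hγE => ⟨AFLF.existsUnique_g_eq hP hR hγ hγE, ?_⟩, fun _ => hrel⟩
  rcases hK.eq_or_lt with rfl | hK2
  -- For `K = 1` the factor `K - 1` makes the second term `0`, whatever the value of `R / 0`.
  · refine (min_le_right _ _).trans (le_trans ?_ hrel)
    rw [EReal.coe_le_coe_iff]
    simpa using AFLF.Er_nonneg hP R
  -- If the reliability reaches the retransmission exponent, the minimum is bounded already.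
  -- Otherwise every `E` near the reliability is below that exponent, and only the first term has to
  -- be treated.
  rcases lt_or_ge (AFLF.reliability P R γ K)
    (((((K : ℝ) - 1) * AFLF.Er P (R / ((K : ℝ) - 1)) : ℝ)) : EReal) with hEK | hEK
  · refine (min_le_left _ _).trans (iSup₂_le fun α hα => iSup₂_le fun lam hlam => ?_)
    exact AFLF.Eee''_le_reliability hP x x' hR hγ hγE hRC hK2 hα hlam.1 hlam.2 hEK
  · exact (min_le_right _ _).trans hEK
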